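/- **Conventions.** Digraphs are finite; their edges are ordered pairs of vertices. $\delta^0(D)$ is the smallest in- or out-degree over the vertices of $D$, and $\Delta^+(T)$, $\Delta^-(T)$ are the maximum out- and in-degree of $T$. An oriented tree is a digraph without loops or pairs of opposite edges whose underlying undirected graph is a tree. $|\cdot|$ denotes the number of vertices, and a copy of $T$ in $D$ is a (not necessarily induced) subgraph of $D$ isomorphic to $T$. **Lemma.** There is a non-decreasing function $f:(0,1]\to(0,1]$ such that the following holds for all $\alpha,\varepsilon,\mu,c\in(0,1]$ and all integers $K,n\ge 1$ with $$\tfrac1n\le f(c),\qquad c\le f(\mu),\qquad \mu\le f(\alpha),\qquad \mu\le f(\varepsilon),\qquad c\le f(1/K)$$ (that is, $1/n\ll c\ll\mu\ll\alpha,\varepsilon$ and $c\ll 1/K$). Let $D$ be an $n$-vertex digraph with $\delta^0(D)\ge(1/2+\alpha)n$ and let $v\in V(D)$. Let $T$ be an oriented tree with $|T|\le(1-\varepsilon)n$, $\Delta^+(T)\le cn/\log n$ and $\Delta^-(T)\le cn/\log n$. Let $\ell\ge 0$ and let $T',S_1,\dots,S_\ell\subset T$ be vertex-disjoint subtrees with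 $|T'|\le\mu n$ and $|S_i|\le K$ for each $1\le i\le\ell$, such that $T$ is formed from $T'$ by attaching each $S_i$ to $T'$ by an edge; that is, $V(T)=V(T')\cup V(S_1)\cup\dots\cup V(S_\ell)$ and the edges of $T$ are those of $T'$, those of $S_1,\dots,S_\ell$, and, for each $i$, exactly one edge, in either direction, between $V(T')$ and $V(S_i)$. Let $t\in V(T')$. Then $D$ contains a copy of $T$ in which $t$ is copied to $v$. -/

import Mathlib

namespace DigraphTrees

/-- The out-degree `d⁺(v)`, the number of out-neighbours of `v`. -/
noncomputable def outDegree {V : Type*} (D : Digraph V) (v : V) : ℕ :=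
  Set.ncard {w | D.Adj v w}

/-- The in-degree `d⁻(v)`, the number of in-neighbours of `v`. -/
noncomputable def inDegree {V : Type*} (D : Digraph V) (v : V) : ℕ :=
  Set.ncard {w | D.Adj w v}

/-- The minimum semidegree `δ⁰(D)`, the smallest in- or out-degree over all vertices
(used for finite nonempty vertex types). -/
noncomputable def minSemidegree {V : Type*} (D : Digraph V) : ℕ :=
  ⨅ v, min (outDegree D v) (inDegree D v)

/-- The maximum out-degree `Δ⁺(D)` (used for finite vertex types). -/
noncomputable def maxOutDegree {V : Type*} (D : Digraph V) : ℕ :=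
  ⨆ v, outDegree D v

/-- The maximum in-degree `Δ⁻(D)` (used for finite vertex types). -/
noncomputable def maxInDegree {V : Type*} (D : Digraph V) : ℕ :=
  ⨆ v, inDegree D v

/-- An oriented tree: a digraph without loops and without pairs of opposite edges
whose underlying undirected graph is a tree. -/
structure IsOrientedTree {W : Type*} (T : Digraph W) : Prop where
  asymm : ∀ a b, T.Adj a b → ¬ T.Adj b a
  isTree : T.toSimpleGraphInclusive.IsTree

/-- The vertex set `A` spans a subtree of `T`. (A subtree of a tree is an induced subgraph, so
subtrees of an oriented tree are given by their vertex sets.) -/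
def IsSubtree {W : Type*} (T : Digraph W) (A : Set W) : Prop :=
  (T.toSimpleGraphInclusive.induce A).IsTree

/-- `T` is formed from its subtree `T'` by attaching each of the subtrees `S i` to `T'` by an
edge: `T'` and the `S i` are vertex-disjoint subtrees covering all vertices of `T`, and the
edges of `T` are those of `T'`, those of the `S i`, and for each `i` exactly one edge, in either
direction, between `T'` and `S i`. -/
structure IsFormedByAttaching {W : Type*} (T : Digraph W) (T' : Set W) {ℓ : ℕ}
    (S : Fin ℓ → Set W) : Prop where
  subtree_core : IsSubtree T T'
  subtree_attached : ∀ i, IsSubtree T (S i)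
  disjoint_core : ∀ i, Disjoint T' (S i)
  disjoint_attached : ∀ i j, i ≠ j → Disjoint (S i) (S j)
  cover : T' ∪ ⋃ i, S i = Set.univ
  attaching_edge : ∀ i, ∃! e : W × W,
    T.Adj e.1 e.2 ∧ ((e.1 ∈ T' ∧ e.2 ∈ S i) ∨ (e.1 ∈ S i ∧ e.2 ∈ T'))
  no_other_edge : ∀ i j, i ≠ j → ∀ a ∈ S i, ∀ b ∈ S j, ¬ T.Adj a b

/-- `D` contains a (not necessarily induced) copy of `T` in which `t` is copied to `v`. -/
def ContainsCopyAt {V W : Type*} (D : Digraph V) (T : Digraph W) (t : W) (v : V) : Prop :=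
  ∃ φ : W → V, Function.Injective φ ∧ (∀ a b, T.Adj a b → D.Adj (φ a) (φ b)) ∧ φ t = v

end DigraphTrees

/-! Only boundedly many types of attached subtrees exist: a type records the size, the parent
function and the directions of all edges, including the attaching edge. A type is good if it occurs
at least `γ * n` times. The subtrees of the other types are absorbed, together with `T'`, into a
core `C` of at most `2 * μ * n` vertices.

The vertices other than `v` are split, as if at random, into parts that every in- and
out-neighbourhood meets proportionally: a set `U s` for the roots attached in direction `s`, one set
of size about `(1 + 2 * η) * N τ` for each non-root position in each good type `τ`, where `N τ` is
the number of subtrees of that type, and a remainder `R` for the core. All random choices are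
derandomised through exponential moments (`exists_balanced_coloring`).

The crux is to embed the core so that the roots can then be placed. Vertices of the core are
embedded one at a time, parents first, and each receives two kernels: probability distributions on
the out- and in-neighbours of its image in `U true` and `U false`, along which its pendant roots are
spread fractionally. For each good type the accumulated load should be almost uniform on `U s`. An
exponential potential over all pairs (type, vertex of `U s`) controls this: its derivative gives
prices on `U true` and `U false`, and the potential does not grow if the next image has kernels
costing about the sum of the two average prices (`sum_exp_potential_le`).

Such an image exists (`exists_cheap_nbrKernel`). Every vertex has more than half of each `U s` as
neighbours, so it can always pay the median price. Double counting gives a candidate with many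
neighbours among the cheapest vertices in one chosen direction, so there it pays the minimum. Since
minimum plus median is at most twice the average, one of the two choices of direction is cheap
enough (`exists_balanced_embedding`). The degree bound `c * n / log n` makes each step small enough
for a union bound over all types and vertices.

A proportional split of `U s` by type turns the even fractional loads into Hall's condition, so the
roots are placed injectively (`exists_root_matching`). The other vertices of the good subtrees
follow by perfect matchings between sets in which every vertex is joined to more than half
(`exists_copies_of_dirNbr`). -/

/-! ### Derandomised balanced colourings -/

/-- Method of conditional expectations. If elements are coloured independently with distribution
`p`, each new summand has mean zero and absolute value at most one, so it multiplies the expected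
exponential by at most `exp (l ^ 2)`. Some colour of the new element does no worse than this
average. -/
theorem exists_coloring_sum_exp_le {V ι J : Type*} [Fintype ι] [DecidableEq ι] [Fintype J]
    (A : Finset V) (p : ι → ℝ) (hp0 : ∀ i, 0 ≤ p i) (hp1 : ∑ i, p i = 1)
    (f : J → V → ℝ) (hf : ∀ j a, |f j a| ≤ 1) {l : ℝ} (hl0 : 0 ≤ l) (hl1 : l ≤ 1) :
    ∃ χ : V → ι,
      ∑ i, ∑ j, Real.exp (l * ∑ a ∈ A, (p i - if χ a = i then 1 else 0) * f j a)
        ≤ Fintype.card ι * Fintype.card J * Real.exp (l ^ 2 * A.card) := by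
  classical
  have hne : Nonempty ι := by
    by_contra h
    rw [not_nonempty_iff] at h
    simp at hp1
  induction A using Finset.induction_on with
  | empty => exact ⟨fun _ => hne.some, by simp⟩
  | insert b A hb ih =>
    obtain ⟨χ, hχ⟩ := ih
    set E : ι → J → ℝ := fun i j =>
      Real.exp (l * ∑ a ∈ A, (p i - if χ a = i then 1 else 0) * f j a) with hE
    have hple : ∀ i, p i ≤ 1 := fun i =>
      hp1 ▸ Finset.single_le_sum (fun i _ => hp0 i) (Finset.mem_univ i)
    have step : ∀ i j, ∑ k, p k * Real.exp (l * ((p i - if k = i then 1 else 0) * f j b))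
        ≤ Real.exp (l ^ 2) := by
      intro i j
      have h1 : ∀ k, Real.exp (l * ((p i - if k = i then 1 else 0) * f j b))
          ≤ 1 + l * ((p i - if k = i then 1 else 0) * f j b) + l ^ 2 := by
        intro k
        set y : ℝ := (p i - if k = i then 1 else 0) * f j b with hy
        have hy1 : |y| ≤ 1 := by
          rw [hy, abs_mul]
          refine mul_le_one₀ ?_ (abs_nonneg _) (hf j b)
          rw [abs_le]
          split_ifs <;> constructor <;> linarith [hp0 i, hple i]
        have hly : |l * y| ≤ 1 := by
          rw [abs_mul, abs_of_nonneg hl0]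
          exact mul_le_one₀ hl1 (abs_nonneg _) hy1
        have h2 := Real.abs_exp_sub_one_sub_id_le hly
        have h3 : (l * y) ^ 2 ≤ l ^ 2 := by
          rw [mul_pow]
          have : y ^ 2 ≤ 1 := by rw [sq_le_one_iff_abs_le_one]; exact hy1
          nlinarith [sq_nonneg l]
        have := (abs_le.mp h2).2
        linarith
      calc ∑ k, p k * Real.exp (l * ((p i - if k = i then 1 else 0) * f j b))
          ≤ ∑ k, p k * (1 + l * ((p i - if k = i then 1 else 0) * f j b) + l ^ 2) :=
            Finset.sum_le_sum fun k _ => mul_le_mul_of_nonneg_left (h1 k) (hp0 k)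
        _ = ∑ k, (p k * (1 + l ^ 2 + l * p i * f j b)
              - (if k = i then p k * (l * f j b) else 0)) := by
            refine Finset.sum_congr rfl fun k _ => ?_
            split_ifs <;> ring
        _ = 1 + l ^ 2 := by
            rw [Finset.sum_sub_distrib, ← Finset.sum_mul, hp1, Finset.sum_ite_eq' Finset.univ i]
            simp; ring
        _ ≤ Real.exp (l ^ 2) := by linarith [Real.add_one_le_exp (l ^ 2)]
    have avg : ∑ k, p k * (∑ i, ∑ j, E i j *
        Real.exp (l * ((p i - if k = i then 1 else 0) * f j b)))
        ≤ ∑ k, p k * (Real.exp (l ^ 2) * ∑ i, ∑ j, E i j) := by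
      rw [← Finset.sum_mul, hp1, one_mul]
      calc ∑ k, p k * (∑ i, ∑ j, E i j *
            Real.exp (l * ((p i - if k = i then 1 else 0) * f j b)))
          = ∑ i, ∑ j, E i j * ∑ k, p k *
            Real.exp (l * ((p i - if k = i then 1 else 0) * f j b)) := by
            simp_rw [Finset.mul_sum]
            rw [Finset.sum_comm]
            refine Finset.sum_congr rfl fun i _ => ?_
            rw [Finset.sum_comm]
            refine Finset.sum_congr rfl fun j _ => Finset.sum_congr rfl fun k _ => by ring
        _ ≤ ∑ i, ∑ j, E i j * Real.exp (l ^ 2) :=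
            Finset.sum_le_sum fun i _ => Finset.sum_le_sum fun j _ =>
              mul_le_mul_of_nonneg_left (step i j) (Real.exp_pos _).le
        _ = Real.exp (l ^ 2) * ∑ i, ∑ j, E i j := by
            simp_rw [← Finset.sum_mul]; ring
    have : ∃ k, ∑ i, ∑ j, E i j * Real.exp (l * ((p i - if k = i then 1 else 0) * f j b))
        ≤ Real.exp (l ^ 2) * ∑ i, ∑ j, E i j := by
      by_contra hcon
      push Not at hcon
      have hex : ∃ k, 0 < p k := by
        by_contra h
        push Not at h
        have : ∑ i, p i ≤ 0 := Finset.sum_nonpos fun i _ => h i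
        linarith
      obtain ⟨k0, hk0⟩ := hex
      refine absurd avg (not_le.mpr ?_)
      exact Finset.sum_lt_sum (fun k _ => mul_le_mul_of_nonneg_left (hcon k).le (hp0 k))
        ⟨k0, Finset.mem_univ _, mul_lt_mul_of_pos_left (hcon k0) hk0⟩
    obtain ⟨k, hk⟩ := this
    refine ⟨Function.update χ b k, ?_⟩
    have hcongr : ∀ i j, Real.exp (l * ∑ a ∈ insert b A,
        (p i - if Function.update χ b k a = i then 1 else 0) * f j a)
        = E i j * Real.exp (l * ((p i - if k = i then 1 else 0) * f j b)) := by
      intro i j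
      rw [hE, Finset.sum_insert hb, ← Real.exp_add]
      congr 1
      rw [Function.update_self, mul_add, add_comm]
      congr 2
      refine Finset.sum_congr rfl fun a ha => ?_
      rw [Function.update_of_ne (ne_of_mem_of_not_mem ha hb)]
    simp_rw [hcongr]
    refine hk.trans ((mul_le_mul_of_nonneg_left hχ (Real.exp_pos _).le).trans (le_of_eq ?_))
    rw [Finset.card_insert_of_notMem hb]
    push_cast
    rw [mul_add, mul_one, Real.exp_add]
    ring

/-- A finite set can be coloured so that every colour class receives its share of each of
finitely many bounded weightings, up to a small error. -/
theorem exists_balanced_coloring {V ι J : Type*} [Fintype ι] [DecidableEq ι] [Fintype J]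
    (A : Finset V) (p : ι → ℝ) (hp0 : ∀ i, 0 ≤ p i) (hp1 : ∑ i, p i = 1)
    (f : J → V → ℝ) (hf : ∀ j a, |f j a| ≤ 1) {δ m : ℝ} (hδ0 : 0 < δ) (hδ1 : δ ≤ 1)
    (hA : (A.card : ℝ) ≤ m)
    (hm : Real.log (Fintype.card ι * Fintype.card J) ≤ δ ^ 2 * m / 4) :
    ∃ χ : V → ι, ∀ i j,
      p i * ∑ a ∈ A, f j a - δ * m ≤ ∑ a ∈ A with χ a = i, f j a := by
  -- With `l = δ / 2`, the logarithm of the number of constraints and the variance term each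
  -- contribute at most `δ ^ 2 * m / 4`. Dividing their sum by `l` gives the deviation `δ * m`.
  obtain ⟨χ, hχ⟩ := exists_coloring_sum_exp_le A p hp0 hp1 f hf
    (l := δ / 2) (by positivity) (by linarith)
  refine ⟨χ, fun i j => ?_⟩
  have h1 : Real.exp (δ / 2 * ∑ a ∈ A, (p i - if χ a = i then 1 else 0) * f j a)
      ≤ Fintype.card ι * Fintype.card J * Real.exp ((δ / 2) ^ 2 * A.card) := by
    refine le_trans ?_ hχ
    refine le_trans ?_ (Finset.single_le_sum
      (fun i _ => Finset.sum_nonneg fun j _ => (Real.exp_pos _).le) (Finset.mem_univ i))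
    exact Finset.single_le_sum (f := fun j => Real.exp (δ / 2 * ∑ a ∈ A,
      (p i - if χ a = i then 1 else 0) * f j a)) (fun j _ => (Real.exp_pos _).le)
      (Finset.mem_univ j)
  have hpos : (0 : ℝ) < Fintype.card ι * Fintype.card J := by
    have : 0 < Fintype.card ι := Fintype.card_pos_iff.mpr ⟨i⟩
    have : 0 < Fintype.card J := Fintype.card_pos_iff.mpr ⟨j⟩
    positivity
  have h2 := Real.log_le_log (Real.exp_pos _) h1
  rw [Real.log_exp, Real.log_mul hpos.ne' (Real.exp_pos _).ne', Real.log_exp] at h2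
  have h3 : ∑ a ∈ A, (p i - if χ a = i then 1 else 0) * f j a
      = p i * ∑ a ∈ A, f j a - ∑ a ∈ A with χ a = i, f j a := by
    rw [Finset.sum_filter, Finset.mul_sum, ← Finset.sum_sub_distrib]
    refine Finset.sum_congr rfl fun a _ => ?_
    split_ifs <;> ring
  rw [h3] at h2
  have h4 : (δ / 2) ^ 2 * (A.card : ℝ) ≤ (δ / 2) ^ 2 * m :=
    mul_le_mul_of_nonneg_left hA (by positivity)
  by_contra hcon
  push Not at hcon
  have h5 : δ / 2 * (δ * m) < δ / 2 * (p i * ∑ a ∈ A, f j a - ∑ a ∈ A with χ a = i, f j a) :=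
    mul_lt_mul_of_pos_left (by linarith) (by positivity)
  nlinarith

/-! ### Matchings from Hall's theorem -/

namespace DigraphTrees

/-- Adjacency along an edge of prescribed direction: `a → b` for `true`, `b → a` for `false`. -/
def DirAdj {V : Type*} (D : Digraph V) (s : Bool) (a b : V) : Prop :=
  match s with
  | true => D.Adj a b
  | false => D.Adj b a

theorem dirAdj_not {V : Type*} (D : Digraph V) (s : Bool) (a b : V) :
    DirAdj D (!s) a b ↔ DirAdj D s b a := by
  cases s <;> rfl

open Classical in
/-- The out-neighbourhood (for `true`) or the in-neighbourhood (for `false`) of a vertex. -/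
noncomputable def dirNbr {V : Type*} [Fintype V] (D : Digraph V) (s : Bool) (a : V) : Finset V :=
  Finset.univ.filter (DirAdj D s a)

theorem mem_dirNbr {V : Type*} [Fintype V] {D : Digraph V} {s : Bool} {a b : V} :
    b ∈ dirNbr D s a ↔ DirAdj D s a b := by
  simp [dirNbr]

theorem mem_dirNbr_not {V : Type*} [Fintype V] {D : Digraph V} {s : Bool} {a b : V} :
    b ∈ dirNbr D (!s) a ↔ a ∈ dirNbr D s b := by
  rw [mem_dirNbr, mem_dirNbr, dirAdj_not]

/-- Hall's condition from weights: rows of weight at least `κ` and columns of weight at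
most `κ`. -/
theorem exists_injective_of_weights {X V : Type*} [Fintype X] [DecidableEq V]
    (A : Finset V) (w : X → V → ℝ) (hw : ∀ x u, 0 ≤ w x u) {κ : ℝ} (hκ : 0 < κ)
    (hrow : ∀ x, κ ≤ ∑ u ∈ A, w x u) (hcol : ∀ u ∈ A, ∑ x, w x u ≤ κ) :
    ∃ g : X → V, Function.Injective g ∧ ∀ x, g x ∈ A ∧ w x (g x) ≠ 0 := by
  classical
  have key := (Finset.all_card_le_biUnion_card_iff_exists_injective
    (fun x => A.filter fun u => w x u ≠ 0)).mp ?_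
  · obtain ⟨g, hg, hg'⟩ := key
    exact ⟨g, hg, fun x => by simpa using hg' x⟩
  · intro S
    set B := S.biUnion fun x => A.filter fun u => w x u ≠ 0 with hB
    have hBA : B ⊆ A := Finset.biUnion_subset.mpr fun x _ => Finset.filter_subset _ _
    -- All the weight of the rows in `S` lies on `B`, so double counting the weight between `S` and
    -- `B` compares their cardinalities.
    have h1 : (S.card : ℝ) * κ ≤ ∑ x ∈ S, ∑ u ∈ B, w x u := by
      rw [← nsmul_eq_mul]
      refine Finset.card_nsmul_le_sum _ _ _ fun x hx => (hrow x).trans (le_of_eq ?_)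
      symm
      refine Finset.sum_subset hBA fun u hu huB => ?_
      by_contra hne
      exact huB (Finset.mem_biUnion.mpr ⟨x, hx, Finset.mem_filter.mpr ⟨hu, hne⟩⟩)
    have h2 : ∑ x ∈ S, ∑ u ∈ B, w x u ≤ B.card * κ := by
      rw [Finset.sum_comm, ← nsmul_eq_mul]
      refine Finset.sum_le_card_nsmul _ _ _ fun u hu => ?_
      exact (Finset.sum_le_univ_sum_of_nonneg fun x => hw x u).trans (hcol u (hBA hu))
    have h3 := le_of_mul_le_mul_right (h1.trans h2) hκ
    exact_mod_cast h3

/-- A matching along edges of direction `s` of an injective family into a set that has large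
intersections with all neighbourhoods. -/
theorem exists_matching_of_dirNbr {V X : Type*} [Fintype V] [DecidableEq V] [Fintype X]
    (D : Digraph V) (s : Bool) (A B : Finset V) (ψ : X → V) (hψ : Function.Injective ψ)
    (hψA : ∀ x, ψ x ∈ A)
    (hA : ∀ b, 2 * A.card ≤ 2 * (dirNbr D (!s) b ∩ A).card + Fintype.card X)
    (hBX : Fintype.card X ≤ B.card)
    (hB : ∀ a, 2 * B.card ≤ 2 * (dirNbr D s a ∩ B).card + Fintype.card X) :
    ∃ g : X → V, Function.Injective g ∧ ∀ x, g x ∈ B ∧ DirAdj D s (ψ x) (g x) := by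
  classical
  have key := (Finset.all_card_le_biUnion_card_iff_exists_injective
    (fun x => dirNbr D s (ψ x) ∩ B)).mp ?_
  · obtain ⟨g, hg, hg'⟩ := key
    refine ⟨g, hg, fun x => ?_⟩
    have := hg' x
    rw [Finset.mem_inter, mem_dirNbr] at this
    exact this.symm
  · intro S
    rcases S.eq_empty_or_nonempty with rfl | ⟨x0, hx0⟩
    · simp
    -- A small `S` is handled by a single neighbourhood, which already has at least `|X| / 2`
    -- elements in `B`. If `S` has more than `|X| / 2` elements, every `b` in `B` is joined to its
    -- image, since `b` misses at most `|X| / 2` vertices of `A`; the union is then all of `B`.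
    by_cases hS : 2 * S.card ≤ Fintype.card X
    · have h1 : (dirNbr D s (ψ x0) ∩ B).card
          ≤ (S.biUnion fun x => dirNbr D s (ψ x) ∩ B).card :=
        Finset.card_le_card (Finset.subset_biUnion_of_mem
          (fun x => dirNbr D s (ψ x) ∩ B) hx0)
      have := hB (ψ x0)
      omega
    · refine (Finset.card_le_univ S).trans (hBX.trans (Finset.card_le_card fun b hb => ?_))
      have hI : (Finset.univ.image ψ) ⊆ A := fun y hy => by
        obtain ⟨x, -, rfl⟩ := Finset.mem_image.mp hy
        exact hψA x
      have hIc : (Finset.univ.image ψ).card = Fintype.card X := by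
        rw [Finset.card_image_of_injective _ hψ, Finset.card_univ]
      have hSc : (S.image ψ).card = S.card := Finset.card_image_of_injective _ hψ
      have hSA : S.image ψ ⊆ A := (Finset.image_subset_image (Finset.subset_univ S)).trans hI
      have hne : ((dirNbr D (!s) b ∩ A) ∩ S.image ψ).Nonempty := by
        rw [Finset.nonempty_iff_ne_empty]
        intro hemp
        have hd := Finset.card_union_of_disjoint (Finset.disjoint_iff_inter_eq_empty.mpr hemp)
        have hle := Finset.card_le_card
          (Finset.union_subset (Finset.inter_subset_right (s₁ := dirNbr D (!s) b)) hSA)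
        have := hA b
        omega
      obtain ⟨y, hy⟩ := hne
      rw [Finset.mem_inter, Finset.mem_inter, Finset.mem_image] at hy
      obtain ⟨⟨hy1, -⟩, x, hx, rfl⟩ := hy
      exact Finset.mem_biUnion.mpr
        ⟨x, hx, Finset.mem_inter.mpr ⟨mem_dirNbr_not.mp hy1, hb⟩⟩

/-- Disjointly placed copies of a rooted oriented tree on `k` ordered vertices (`p j` is the
parent of `j`, `d j` the direction of the edge from it), the `j`-th vertices of all the copies
lying in `B j`, with prescribed roots. -/
theorem exists_copies_of_dirNbr {V X : Type*} [Fintype V] [DecidableEq V] [Fintype X]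
    (D : Digraph V) (k : ℕ) (p : ℕ → ℕ) (d : ℕ → Bool) (hp : ∀ j, 0 < j → j < k → p j < j)
    (B : ℕ → Finset V) (ψ₀ : X → V) (hψ₀ : Function.Injective ψ₀) (hψB : ∀ x, ψ₀ x ∈ B 0)
    (hBX : ∀ j < k, Fintype.card X ≤ (B j).card)
    (hB : ∀ j < k, ∀ s a, 2 * (B j).card ≤ 2 * (dirNbr D s a ∩ B j).card + Fintype.card X) :
    ∃ ψ : ℕ → X → V, ψ 0 = ψ₀ ∧ ∀ j < k, Function.Injective (ψ j) ∧ (∀ x, ψ j x ∈ B j) ∧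
      (0 < j → ∀ x, DirAdj D (d j) (ψ (p j) x) (ψ j x)) := by
  induction k with
  | zero => exact ⟨fun _ => ψ₀, rfl, by simp⟩
  | succ k ih =>
    obtain ⟨ψ, h0, hψ⟩ := ih (fun j h1 h2 => hp j h1 (by omega)) (fun j h => hBX j (by omega))
      (fun j h => hB j (by omega))
    rcases Nat.eq_zero_or_pos k with rfl | hk
    · refine ⟨fun _ => ψ₀, rfl, fun j hj => ?_⟩
      obtain rfl : j = 0 := by omega
      exact ⟨hψ₀, hψB, by simp⟩
    have hpk := hp k hk (by omega)
    obtain ⟨i1, i2, -⟩ := hψ (p k) hpk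
    obtain ⟨g, hg, hg'⟩ := exists_matching_of_dirNbr D (d k) (B (p k)) (B k) (ψ (p k)) i1 i2
      (fun b => hB _ (by omega) _ b) (hBX k (by omega)) (fun a => hB k (by omega) _ a)
    refine ⟨Function.update ψ k g, ?_, fun j hj => ?_⟩
    · rw [Function.update_of_ne hk.ne, h0]
    · rcases Nat.lt_succ_iff_lt_or_eq.mp hj with hj | rfl
      · obtain ⟨a1, a2, a3⟩ := hψ j hj
        rw [Function.update_of_ne hj.ne]
        refine ⟨a1, a2, fun h => ?_⟩
        have := hp j h (by omega)
        rw [Function.update_of_ne (by omega)]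
        exact a3 h
      · rw [Function.update_self, Function.update_of_ne hpk.ne]
        exact ⟨hg, fun x => (hg' x).1, fun _ x => (hg' x).2⟩

end DigraphTrees

/-! ### Cheap neighbourhoods under given prices -/

theorem Finset.exists_lower_subset_card_eq {V : Type*} [DecidableEq V] (U : Finset V) (g : V → ℝ)
    {h : ℕ} (hh : h ≤ U.card) :
    ∃ H ⊆ U, H.card = h ∧ ∀ a ∈ H, ∀ b ∈ U \ H, g a ≤ g b := by
  induction h with
  | zero => exact ⟨∅, by simp, by simp, by simp⟩
  | succ h ih =>
    obtain ⟨H, hHU, hH, hlow⟩ := ih (by omega)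
    have hne : (U \ H).Nonempty := by
      rw [← Finset.card_pos, Finset.card_sdiff_of_subset hHU]; omega
    obtain ⟨x, hx, hmin⟩ := Finset.exists_min_image (U \ H) g hne
    have hx' := Finset.mem_sdiff.mp hx
    refine ⟨insert x H, Finset.insert_subset hx'.1 hHU, ?_, ?_⟩
    · rw [Finset.card_insert_of_notMem hx'.2, hH]
    · intro a ha b hb
      have hb' : b ∈ U \ H := by
        rw [Finset.mem_sdiff] at hb ⊢
        exact ⟨hb.1, fun hbH => hb.2 (Finset.mem_insert_of_mem hbH)⟩
      rcases Finset.mem_insert.mp ha with rfl | ha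
      · exact hmin b hb'
      · exact hlow a ha b hb'

theorem Finset.exists_lower_subset_threshold {V : Type*} [DecidableEq V] (U : Finset V)
    (g : V → ℝ) {h : ℕ} (h0 : 0 < h) (hh : h ≤ U.card) :
    ∃ H ⊆ U, H.card = h ∧ ∃ x ∈ H, (∀ a ∈ H, g a ≤ g x) ∧ ∀ b ∈ U \ H, g x ≤ g b := by
  obtain ⟨H, hHU, hH, hlow⟩ := Finset.exists_lower_subset_card_eq U g hh
  obtain ⟨x, hx, hmax⟩ := Finset.exists_max_image H g (Finset.card_pos.mp (by omega))
  exact ⟨H, hHU, hH, x, hx, hmax, hlow x hx⟩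

/-- The minimum (up to a proportion `β`) and the median of a nonnegative function add up to at
most twice its average. -/
theorem exists_low_sets {V : Type*} [DecidableEq V] (U : Finset V) (g : V → ℝ)
    (hg : ∀ u, 0 ≤ g u) {β : ℝ} (hβ0 : 0 < β) (hβ : β ≤ 1 / 4) (hβU : 1 ≤ β * U.card) :
    ∃ B ⊆ U, ∃ H ⊆ U, ∃ b m : ℝ, β * U.card ≤ B.card ∧ ((U.card : ℝ) - 1) / 2 ≤ H.card ∧
      (∀ u ∈ B, g u ≤ b) ∧ (∀ u ∈ H, g u ≤ m) ∧
      b + m ≤ 2 * ((1 + 4 * β) * ((∑ u ∈ U, g u) / U.card)) := by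
  set M : ℝ := (U.card : ℝ) with hM
  have hM4 : 4 ≤ M := by nlinarith
  have hMn : 4 ≤ U.card := by rw [hM] at hM4; exact_mod_cast hM4
  have hc1 := Nat.ceil_lt_add_one (a := β * M) (by positivity)
  have hc2 := Nat.le_ceil (β * M)
  have hh : (M - 1) / 2 ≤ ((U.card / 2 : ℕ) : ℝ) := by
    have h1 : U.card ≤ 2 * (U.card / 2) + 1 := by omega
    have h2 : M ≤ 2 * ((U.card / 2 : ℕ) : ℝ) + 1 := by rw [hM]; exact_mod_cast h1
    linarith
  have hh2 : ((U.card / 2 : ℕ) : ℝ) ≤ M / 2 := by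
    have h1 : 2 * (U.card / 2) ≤ U.card := by omega
    have h2 : 2 * ((U.card / 2 : ℕ) : ℝ) ≤ M := by rw [hM]; exact_mod_cast h1
    linarith
  obtain ⟨H, hHU, hHc, x, hxH, hmaxH, hminH⟩ :=
    Finset.exists_lower_subset_threshold U g (h := U.card / 2) (by omega) (by omega)
  have hbh : ⌈β * M⌉₊ ≤ H.card := by
    rw [hHc, ← Nat.lt_succ_iff]
    have : ((⌈β * M⌉₊ : ℕ) : ℝ) < ((U.card / 2 : ℕ) : ℝ) + 1 := by nlinarith
    exact_mod_cast this
  obtain ⟨B, hBH, hBc, y, hyB, hmaxB, hminB⟩ :=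
    Finset.exists_lower_subset_threshold H g (h := ⌈β * M⌉₊)
      (Nat.ceil_pos.mpr (by positivity)) hbh
  have hyx : g y ≤ g x := hmaxH y (hBH hyB)
  have s1 : ((U \ H).card : ℝ) * g x ≤ ∑ u ∈ U \ H, g u := by
    rw [← nsmul_eq_mul]; exact Finset.card_nsmul_le_sum _ _ _ hminH
  have s2 : ((H \ B).card : ℝ) * g y ≤ ∑ u ∈ H \ B, g u := by
    rw [← nsmul_eq_mul]; exact Finset.card_nsmul_le_sum _ _ _ hminB
  have e1 : ∑ u ∈ U \ H, g u + ∑ u ∈ H, g u = ∑ u ∈ U, g u := Finset.sum_sdiff hHU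
  have e2 : ∑ u ∈ H \ B, g u + ∑ u ∈ B, g u = ∑ u ∈ H, g u := Finset.sum_sdiff hBH
  have e3 : 0 ≤ ∑ u ∈ B, g u := Finset.sum_nonneg fun u _ => hg u
  rw [Finset.cast_card_sdiff hHU, hHc] at s1
  rw [Finset.cast_card_sdiff hBH, hHc, hBc] at s2
  rw [← hM] at s1
  set S := ∑ u ∈ U, g u
  set h : ℝ := ((U.card / 2 : ℕ) : ℝ)
  set b0 : ℝ := (⌈β * M⌉₊ : ℝ)
  have hb0 : b0 ≤ 2 * (β * M) := by linarith
  -- At least half of `U` costs no less than `g y`, up to the exceptional set `B`; hence the crude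
  -- bound `2 * S / M` for the minimum.
  have hb : M * g y ≤ 2 * S := by
    have h1 : (M - h) * g y ≤ (M - h) * g x := mul_le_mul_of_nonneg_left hyx (by linarith)
    have h2 : b0 * g y ≤ M / 2 * g y := mul_le_mul_of_nonneg_right (by nlinarith) (hg y)
    linarith
  have hS : 0 ≤ S := Finset.sum_nonneg fun u _ => hg u
  refine ⟨B, hBH.trans hHU, H, hHU, g y, g x, ?_, ?_, hmaxB, hmaxH, ?_⟩
  · rw [hBc]; exact hc2
  · rw [hHc]; exact hh
  · have hMpos : 0 < M := by linarith
    -- The upper part, of size `M - h`, costs at least `g x` each, and `H \ B` at least `g y` each.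
    -- As `g y ≤ g x` and `h ≤ M / 2`, both prices may be given weight `M / 2`; the loss from
    -- ignoring `B` is the last term.
    have t1 : M * (g x + g y) ≤ 2 * S + 2 * b0 * g y := by
      nlinarith [mul_nonneg (sub_nonneg.mpr hyx) (show 0 ≤ M - 2 * h by linarith)]
    have t2 : 2 * b0 * g y ≤ 8 * β * S := by
      have : 2 * b0 * g y ≤ 4 * (β * M) * g y :=
        mul_le_mul_of_nonneg_right (by linarith) (hg y)
      nlinarith [mul_le_mul_of_nonneg_left hb hβ0.le]
    have : 2 * ((1 + 4 * β) * (S / M)) = (2 * (1 + 4 * β) * S) / M := by ring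
    rw [this, le_div_iff₀ hMpos]
    nlinarith

namespace DigraphTrees

/-- `K` consists of two probability distributions, on the out-neighbours of `w` in `U true` and
on its in-neighbours in `U false`, of density at most `c` relative to the uniform ones. -/
structure IsNbrKernel {V : Type*} (D : Digraph V) (U : Bool → Finset V) (c : ℝ) (w : V)
    (K : Bool → V → ℝ) : Prop where
  nonneg : ∀ s u, 0 ≤ K s u
  support : ∀ s u, K s u ≠ 0 → u ∈ U s ∧ DirAdj D s w u
  sum_eq_one : ∀ s, ∑ u ∈ U s, K s u = 1
  le : ∀ s u, K s u ≤ c / (U s).card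

/-- The uniform distributions on the neighbours of `w` in `B s` work: these sets make up at least
the proportion `1 / c` of `U s`. -/
theorem exists_isNbrKernel {V : Type*} [Fintype V] [DecidableEq V] (D : Digraph V)
    (U : Bool → Finset V) {c : ℝ} (hc : 0 < c) (hU : ∀ s, (U s).Nonempty) (w : V)
    (B : Bool → Finset V) (hB : ∀ s, B s ⊆ U s)
    (hF : ∀ s, (U s).card / c ≤ ((dirNbr D s w ∩ B s).card : ℝ)) :
    ∃ K, IsNbrKernel D U c w K ∧ ∀ s u, K s u ≠ 0 → u ∈ B s := by
  have hpos : ∀ s, (0 : ℝ) < (dirNbr D s w ∩ B s).card := fun s =>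
    lt_of_lt_of_le (by have := (hU s).card_pos; positivity) (hF s)
  have hsupp : ∀ s u, (if u ∈ dirNbr D s w ∩ B s then
      1 / ((dirNbr D s w ∩ B s).card : ℝ) else 0) ≠ 0 → u ∈ dirNbr D s w ∩ B s := by
    intro s u h
    by_contra hu
    exact h (if_neg hu)
  refine ⟨fun s u => if u ∈ dirNbr D s w ∩ B s then
    1 / ((dirNbr D s w ∩ B s).card : ℝ) else 0,
    ⟨fun s u => ?_, fun s u h => ?_, fun s => ?_, fun s u => ?_⟩,
    fun s u h => (Finset.mem_inter.mp (hsupp s u h)).2⟩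
  · split_ifs
    · positivity
    · exact le_rfl
  · have := hsupp s u h
    rw [Finset.mem_inter, mem_dirNbr] at this
    exact ⟨hB s this.2, this.1⟩
  · rw [← Finset.sum_filter, Finset.sum_const, nsmul_eq_mul, Finset.filter_mem_eq_inter,
      Finset.inter_eq_right.mpr (Finset.inter_subset_right.trans (hB s))]
    field_simp [(hpos s).ne']
  · have h1 : 1 / ((dirNbr D s w ∩ B s).card : ℝ) ≤ c / (U s).card := by
      have hUc : (0 : ℝ) < (U s).card := by have := (hU s).card_pos; positivity
      rw [div_le_div_iff₀ (hpos s) hUc]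
      have := hF s
      rw [div_le_iff₀ hc] at this
      linarith
    split_ifs
    · exact h1
    · exact le_trans (by positivity) h1

/-- Double counting of the edges between `Q` and `B`: some `w` does at least as well as the average.
-/
theorem exists_mem_large_dirNbr {V : Type*} [Fintype V] [DecidableEq V] (D : Digraph V)
    (s : Bool) (Q B : Finset V) {a r : ℝ} (hB : B.Nonempty) (ha : 0 < a) (hr : 0 < r)
    (hQ : (Q.card : ℝ) ≤ r) (hd : ∀ u ∈ B, a * r ≤ (dirNbr D (!s) u ∩ Q).card) :
    ∃ w ∈ Q, a * B.card ≤ (dirNbr D s w ∩ B).card := by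
  classical
  by_contra hcon
  push Not at hcon
  have hdc : ∑ w ∈ Q, (dirNbr D s w ∩ B).card = ∑ u ∈ B, (dirNbr D (!s) u ∩ Q).card := by
    have e1 : ∀ w, (dirNbr D s w ∩ B).card = (B.filter fun u => DirAdj D s w u).card := by
      intro w; congr 1; ext u; simp [mem_dirNbr, and_comm]
    have e2 : ∀ u, (dirNbr D (!s) u ∩ Q).card = (Q.filter fun w => DirAdj D s w u).card := by
      intro w; congr 1; ext u; simp [mem_dirNbr, dirAdj_not, and_comm]
    simp_rw [e1, e2]
    exact Finset.sum_card_bipartiteAbove_eq_sum_card_bipartiteBelow (fun w u => DirAdj D s w u)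
  have hQne : Q.Nonempty := by
    obtain ⟨u, hu⟩ := hB
    have h1 := hd u hu
    have h2 : (0 : ℝ) < (dirNbr D (!s) u ∩ Q).card := lt_of_lt_of_le (by positivity) h1
    have h3 : 0 < (dirNbr D (!s) u ∩ Q).card := by exact_mod_cast h2
    exact (Finset.card_pos.mp h3).mono Finset.inter_subset_right
  have h1 : ∑ w ∈ Q, ((dirNbr D s w ∩ B).card : ℝ) < ∑ _w ∈ Q, a * (B.card : ℝ) :=
    Finset.sum_lt_sum_of_nonempty hQne hcon
  have h2 : ∑ _u ∈ B, a * r ≤ ∑ u ∈ B, ((dirNbr D (!s) u ∩ Q).card : ℝ) :=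
    Finset.sum_le_sum hd
  have h3 : ∑ w ∈ Q, ((dirNbr D s w ∩ B).card : ℝ) = ∑ u ∈ B, ((dirNbr D (!s) u ∩ Q).card : ℝ) := by
    exact_mod_cast hdc
  rw [Finset.sum_const, nsmul_eq_mul] at h1 h2
  have : (Q.card : ℝ) * (a * B.card) ≤ r * (a * B.card) :=
    mul_le_mul_of_nonneg_right hQ (by positivity)
  linarith

/-- For any prices on `U true` and `U false` some candidate `w` has kernels on its out- and
in-neighbours whose total cost is essentially at most the sum of the average prices. -/
theorem exists_cheap_nbrKernel {V : Type*} [Fintype V] [DecidableEq V] (D : Digraph V)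
    (Q : Finset V) (U : Bool → Finset V) (g : Bool → V → ℝ) (hg : ∀ s u, 0 ≤ g s u)
    {a β r : ℝ} (ha0 : 0 < a) (hβ0 : 0 < β) (hβ : β ≤ 1 / 4) (hr : 0 < r)
    (hQ : (Q.card : ℝ) ≤ r) (hβU : ∀ s, 1 ≤ β * (U s).card) (haU : ∀ s, 1 ≤ a * (U s).card)
    (hdQ : ∀ s, ∀ u ∈ U s, a * r ≤ (dirNbr D (!s) u ∩ Q).card)
    (hdU : ∀ s, ∀ w ∈ Q, (1 / 2 + a) * (U s).card ≤ (dirNbr D s w ∩ U s).card) :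
    ∃ w ∈ Q, ∃ K, IsNbrKernel D U (1 / (a * β)) w K ∧
      ∑ s, ∑ u ∈ U s, K s u * g s u
        ≤ (1 + 4 * β) * ∑ s, (∑ u ∈ U s, g s u) / (U s).card := by
  classical
  choose B hBU H hHU b m hBc hHc hb hm hbm using fun s =>
    exists_low_sets (U s) (g s) (hg s) hβ0 hβ (hβU s)
  have hUpos : ∀ s, (0 : ℝ) < (U s).card := fun s => by
    by_contra h
    have := hβU s
    nlinarith
  -- The two choices of `s₀` together cost both minima and both medians, which is at most twice the
  -- sum of the averages up to the factor `1 + 4 * β`.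
  have hex : ∃ s₀, b s₀ + m (!s₀) ≤ (1 + 4 * β) * ∑ s, (∑ u ∈ U s, g s u) / (U s).card := by
    by_contra hcon
    push Not at hcon
    have h1 := hcon true
    have h2 := hcon false
    have h3 := hbm true
    have h4 := hbm false
    simp only [Fintype.sum_bool, Bool.not_true, Bool.not_false] at h1 h2
    linarith
  obtain ⟨s₀, hs₀⟩ := hex
  have hBne : (B s₀).Nonempty := by
    rw [← Finset.card_pos]
    have : (0 : ℝ) < (B s₀).card := lt_of_lt_of_le one_pos ((hβU s₀).trans (hBc s₀))
    exact_mod_cast this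
  -- Only direction `s₀` needs a special `w`: in the other direction any candidate has many
  -- neighbours in the cheaper half.
  obtain ⟨w, hwQ, hw⟩ := exists_mem_large_dirNbr D s₀ Q (B s₀) hBne ha0 hr hQ
    (fun u hu => hdQ s₀ u (hBU s₀ hu))
  set A : Bool → Finset V := fun s => if s = s₀ then B s else H s with hA
  set cst : Bool → ℝ := fun s => if s = s₀ then b s else m s with hcst
  have hAU : ∀ s, A s ⊆ U s := fun s => by
    simp only [hA]; split_ifs
    · exact hBU s
    · exact hHU s
  have hAc : ∀ s, ∀ u ∈ A s, g s u ≤ cst s := fun s u hu => by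
    simp only [hA, hcst] at hu ⊢
    split_ifs at hu ⊢ with h
    · exact hb s u hu
    · exact hm s u hu
  have hF : ∀ s, (U s).card / (1 / (a * β)) ≤ ((dirNbr D s w ∩ A s).card : ℝ) := by
    intro s
    have e : (U s).card / (1 / (a * β)) = a * (β * (U s).card) := by field_simp
    rw [e]
    by_cases h : s = s₀
    · subst h
      simp only [hA, if_true]
      exact (mul_le_mul_of_nonneg_left (hBc s) ha0.le).trans hw
    · simp only [hA, if_neg h]
      have h1 := hdU s w hwQ
      -- Inclusion-exclusion in `U s`: a neighbourhood slightly larger than half meets the cheaper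
      -- half in a positive proportion.
      have h2 : (dirNbr D s w ∩ U s).card + (H s).card
          ≤ (dirNbr D s w ∩ H s).card + (U s).card := by
        have h3 := Finset.card_union_add_card_inter (dirNbr D s w ∩ U s) (H s)
        have h4 : ((dirNbr D s w ∩ U s) ∪ H s).card ≤ (U s).card :=
          Finset.card_le_card (Finset.union_subset Finset.inter_subset_right (hHU s))
        have h5 : ((dirNbr D s w ∩ U s) ∩ H s).card ≤ (dirNbr D s w ∩ H s).card :=
          Finset.card_le_card (Finset.inter_subset_inter_right Finset.inter_subset_left)
        omega
      have h3 : ((dirNbr D s w ∩ U s).card : ℝ) + (H s).card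
          ≤ (dirNbr D s w ∩ H s).card + (U s).card := by exact_mod_cast h2
      have h4 := hHc s
      have h5 := haU s
      have h6 : a * (β * (U s).card) ≤ a * (U s).card * (1 / 4) := by
        nlinarith [mul_le_mul_of_nonneg_left hβ (mul_nonneg ha0.le (hUpos s).le)]
      linarith
  have hUne : ∀ s, (U s).Nonempty := fun s => by
    rw [← Finset.card_pos]; exact_mod_cast hUpos s
  obtain ⟨K, hK, hKA⟩ :=
    exists_isNbrKernel D U (c := 1 / (a * β)) (by positivity) hUne w A hAU hF
  refine ⟨w, hwQ, K, hK, le_trans ?_ hs₀⟩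
  have hcost : ∀ s, ∑ u ∈ U s, K s u * g s u ≤ cst s := by
    intro s
    rw [← one_mul (cst s), ← hK.sum_eq_one s, Finset.sum_mul]
    refine Finset.sum_le_sum fun u _ => ?_
    by_cases hu : K s u = 0
    · simp [hu]
    · exact mul_le_mul_of_nonneg_left (hAc s u (hKA s u hu)) (hK.nonneg s u)
  calc _ ≤ ∑ s, cst s := Finset.sum_le_sum fun s _ => hcost s
    _ = b s₀ + m (!s₀) := by
      cases s₀ <;> simp [hcst, add_comm]

end DigraphTrees

/-! ### Exponential potential and the embedding of the core -/

namespace DigraphTrees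

theorem exp_le_one_add_mul {β y : ℝ} (hβ : β ≤ 1) (hy0 : 0 ≤ y) (hy : y ≤ β) :
    Real.exp y ≤ 1 + (1 + β) * y := by
  have h := (abs_le.mp (Real.abs_exp_sub_one_sub_id_le (x := y)
    (by rw [abs_of_nonneg hy0]; linarith))).2
  nlinarith

/-- If the kernel is cheap with respect to the prices coming from an exponential potential, then
the potential does not increase. -/
theorem sum_exp_potential_le {V J : Type*} [Fintype J] (U : Bool → Finset V)
    (sg : J → Bool) (wt : J → ℝ) (h : J → V → ℝ) (hh : ∀ τ u, 0 ≤ h τ u)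
    (K : Bool → V → ℝ) {β : ℝ} (hβ0 : 0 ≤ β) (hβ : β ≤ 1)
    (hUpos : ∀ s, (0 : ℝ) < (U s).card)
    (hy0 : ∀ τ u, 0 ≤ wt τ * (U (sg τ)).card * K (sg τ) u)
    (hy : ∀ τ u, wt τ * (U (sg τ)).card * K (sg τ) u ≤ β)
    (hcost : ∑ s, ∑ u ∈ U s, K s u * (∑ τ, if sg τ = s then
        Real.exp (-((1 + 4 * β) * (1 + β) * wt τ)) * ((1 + β) * wt τ * (U s).card) * h τ u else 0)
      ≤ (1 + 4 * β) * ∑ s, (∑ u ∈ U s, ∑ τ, if sg τ = s then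
        Real.exp (-((1 + 4 * β) * (1 + β) * wt τ)) * ((1 + β) * wt τ * (U s).card) * h τ u else 0)
          / (U s).card) :
    ∑ τ, ∑ u ∈ U (sg τ), h τ u * Real.exp (wt τ * (U (sg τ)).card * K (sg τ) u
        - (1 + 4 * β) * (1 + β) * wt τ) ≤ ∑ τ, ∑ u ∈ U (sg τ), h τ u := by
  set ξ : ℝ := (1 + 4 * β) * (1 + β) with hξ
  set e : J → ℝ := fun τ => Real.exp (-(ξ * wt τ)) with he
  have he0 : ∀ τ, 0 ≤ e τ := fun τ => (Real.exp_pos _).le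
  have s1 : ∑ s, ∑ u ∈ U s, K s u * (∑ τ, if sg τ = s then
        e τ * ((1 + β) * wt τ * (U s).card) * h τ u else 0)
      = ∑ τ, ∑ u ∈ U (sg τ), h τ u * e τ * ((1 + β) * (wt τ * (U (sg τ)).card * K (sg τ) u)) := by
    simp_rw [Finset.mul_sum]
    calc _ = ∑ s, ∑ τ, ∑ u ∈ U s, K s u * (if sg τ = s then
        e τ * ((1 + β) * wt τ * (U s).card) * h τ u else 0) :=
          Finset.sum_congr rfl fun s _ => Finset.sum_comm
      _ = ∑ τ, ∑ s, if sg τ = s then (∑ u ∈ U s, K s u *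
        (e τ * ((1 + β) * wt τ * (U s).card) * h τ u)) else 0 := by
          rw [Finset.sum_comm]
          refine Finset.sum_congr rfl fun τ _ => Finset.sum_congr rfl fun s _ => ?_
          split_ifs <;> simp
      _ = _ := by
          refine Finset.sum_congr rfl fun τ _ => ?_
          rw [Finset.sum_ite_eq Finset.univ (sg τ)]
          simp only [Finset.mem_univ, if_true]
          exact Finset.sum_congr rfl fun u _ => by ring
  have s2 : ∑ s, (∑ u ∈ U s, ∑ τ, if sg τ = s then
        e τ * ((1 + β) * wt τ * (U s).card) * h τ u else 0) / (U s).card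
      = ∑ τ, e τ * ((1 + β) * wt τ) * ∑ u ∈ U (sg τ), h τ u := by
    calc _ = ∑ s, ∑ τ, if sg τ = s then
        (e τ * ((1 + β) * wt τ) * ∑ u ∈ U s, h τ u) else 0 := by
          refine Finset.sum_congr rfl fun s _ => ?_
          rw [Finset.sum_comm, Finset.sum_div]
          refine Finset.sum_congr rfl fun τ _ => ?_
          split_ifs
          · rw [Finset.mul_sum, Finset.sum_div]
            refine Finset.sum_congr rfl fun u _ => ?_
            field_simp [(hUpos s).ne']
          · simp
      _ = _ := by
          rw [Finset.sum_comm]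
          refine Finset.sum_congr rfl fun τ _ => ?_
          rw [Finset.sum_ite_eq Finset.univ (sg τ)]
          simp
  rw [s1, s2] at hcost
  -- The exponential is replaced by its linear bound `1 + (1 + β) * y`, whose linear part is exactly
  -- the cost in `hcost`. Cheapness turns that part into `ξ * wt τ` times the old potential, and the
  -- discount `e τ` compensates because `(1 + z) * exp (-z) ≤ 1`.
  calc ∑ τ, ∑ u ∈ U (sg τ), h τ u * Real.exp (wt τ * (U (sg τ)).card * K (sg τ) u - ξ * wt τ)
      ≤ ∑ τ, ∑ u ∈ U (sg τ), (h τ u * e τ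
          + h τ u * e τ * ((1 + β) * (wt τ * (U (sg τ)).card * K (sg τ) u))) := by
        refine Finset.sum_le_sum fun τ _ => Finset.sum_le_sum fun u _ => ?_
        rw [sub_eq_add_neg, Real.exp_add]
        have := exp_le_one_add_mul hβ (hy0 τ u) (hy τ u)
        have h2 := mul_le_mul_of_nonneg_left this (mul_nonneg (hh τ u) (he0 τ))
        calc _ = h τ u * e τ * Real.exp (wt τ * (U (sg τ)).card * K (sg τ) u) := by
              rw [he]; ring
          _ ≤ _ := h2.trans (le_of_eq (by ring))
    _ = ∑ τ, ∑ u ∈ U (sg τ), h τ u * e τ + ∑ τ, ∑ u ∈ U (sg τ),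
          h τ u * e τ * ((1 + β) * (wt τ * (U (sg τ)).card * K (sg τ) u)) := by
        simp_rw [Finset.sum_add_distrib]
    _ ≤ ∑ τ, ∑ u ∈ U (sg τ), h τ u * e τ
          + (1 + 4 * β) * ∑ τ, e τ * ((1 + β) * wt τ) * ∑ u ∈ U (sg τ), h τ u := by
        linarith
    _ = ∑ τ, e τ * (ξ * wt τ + 1) * ∑ u ∈ U (sg τ), h τ u := by
        rw [Finset.mul_sum, ← Finset.sum_add_distrib]
        refine Finset.sum_congr rfl fun τ _ => ?_
        rw [← Finset.sum_mul, hξ]; ring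
    _ ≤ ∑ τ, ∑ u ∈ U (sg τ), h τ u := by
        refine Finset.sum_le_sum fun τ _ => ?_
        have h1 : e τ * (ξ * wt τ + 1) ≤ 1 := by
          calc e τ * (ξ * wt τ + 1) ≤ e τ * Real.exp (ξ * wt τ) :=
                mul_le_mul_of_nonneg_left (Real.add_one_le_exp _) (he0 τ)
            _ = 1 := by rw [he, ← Real.exp_add]; simp
        have h2 : 0 ≤ ∑ u ∈ U (sg τ), h τ u := Finset.sum_nonneg fun u _ => hh τ u
        calc _ ≤ 1 * ∑ u ∈ U (sg τ), h τ u := mul_le_mul_of_nonneg_right h1 h2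
          _ = _ := one_mul _

/-- Embedding a small rooted tree `P` so that fractional copies of weighted pendant neighbours of
its vertices are spread evenly over `U true` and `U false`. -/
theorem exists_balanced_embedding {V W J : Type*} [Fintype V] [DecidableEq V] [DecidableEq W]
    [Fintype J] (D : Digraph V) (par : W → W) (rk : W → ℕ) (dir : W → Bool) (t : W) (v : V)
    (R : Finset V) (U : Bool → Finset V) (sg : J → Bool) (wt : J → W → ℝ)
    (hwt : ∀ τ x, 0 ≤ wt τ x) {α β : ℝ} (hα0 : 0 < α) (hβ0 : 0 < β)
    (hβ : β ≤ 1 / 4) (hβU : ∀ s, 1 ≤ β * (U s).card) (haU : ∀ s, 1 ≤ α / 2 * (U s).card)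
    (hRpos : R.Nonempty)
    (hdR : ∀ s a, (1 / 2 + α / 2) * R.card ≤ (dirNbr D s a ∩ R).card)
    (hdU : ∀ s a, (1 / 2 + α / 2) * (U s).card ≤ (dirNbr D s a ∩ U s).card)
    (hsmall : ∀ τ x, wt τ x * (1 / (α / 2 * β)) ≤ β)
    (P : Finset W) (htP : t ∈ P)
    (hpar : ∀ x ∈ P, x ≠ t → par x ∈ P ∧ rk (par x) < rk x)
    (hPR : (P.card : ℝ) ≤ α / 2 * R.card) :
    ∃ (φ : W → V) (K : W → Bool → V → ℝ), φ t = v ∧ Set.InjOn φ P ∧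
      (∀ x ∈ P, x ≠ t → φ x ∈ R) ∧
      (∀ x ∈ P, x ≠ t → DirAdj D (dir x) (φ (par x)) (φ x)) ∧
      (∀ x ∈ P, IsNbrKernel D U (1 / (α / 2 * β)) (φ x) (K x)) ∧
      ∑ τ, ∑ u ∈ U (sg τ), Real.exp (∑ x ∈ P, (wt τ x * (U (sg τ)).card * K x (sg τ) u
        - (1 + 4 * β) * (1 + β) * wt τ x)) ≤ Real.exp 1 * ∑ τ, ((U (sg τ)).card : ℝ) := by
  have hUpos : ∀ s, (0 : ℝ) < (U s).card := fun s => by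
    by_contra h
    have := hβU s
    nlinarith
  have hUne : ∀ s, (U s).Nonempty := fun s => by
    rw [← Finset.card_pos]; exact_mod_cast hUpos s
  have hyle : ∀ (K : Bool → V → ℝ) (w : V), IsNbrKernel D U (1 / (α / 2 * β)) w K →
      ∀ τ x u, wt τ x * (U (sg τ)).card * K (sg τ) u ≤ β := by
    intro K w hK τ x u
    refine le_trans ?_ (hsmall τ x)
    rw [mul_assoc]
    refine mul_le_mul_of_nonneg_left ?_ (hwt τ x)
    have := hK.le (sg τ) u
    rw [le_div_iff₀ (hUpos _)] at this
    linarith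
  have hy0 : ∀ (K : Bool → V → ℝ) (w : V), IsNbrKernel D U (1 / (α / 2 * β)) w K →
      ∀ τ x u, 0 ≤ wt τ x * (U (sg τ)).card * K (sg τ) u := fun K w hK τ x u =>
    mul_nonneg (mul_nonneg (hwt τ x) (hUpos _).le) (hK.nonneg _ _)
  induction hn : P.card generalizing P with
  | zero => simp [Finset.card_eq_zero.mp hn] at htP
  | succ n ih =>
    rcases (P.erase t).eq_empty_or_nonempty with hemp | hne
    -- The image of the root is prescribed, so no cheap choice is possible. Its kernel changes the
    -- exponent by at most `β ≤ 1`; this is the factor `Real.exp 1` in the conclusion.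
    · have hPt : P = {t} := by
        rw [← Finset.insert_erase htP, hemp]; rfl
      subst hPt
      obtain ⟨K, hK, -⟩ := exists_isNbrKernel D U (c := 1 / (α / 2 * β)) (by positivity) hUne v U
        (fun s => le_rfl) (fun s => by
          have e : (U s).card / (1 / (α / 2 * β)) = α / 2 * β * (U s).card := by field_simp
          rw [e]
          refine le_trans ?_ (hdU s v)
          exact mul_le_mul_of_nonneg_right (by nlinarith) (hUpos s).le)
      refine ⟨fun _ => v, fun _ => K, rfl, by simp, by simp, by simp, by simpa using hK, ?_⟩
      rw [Finset.mul_sum]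
      refine Finset.sum_le_sum fun τ _ => ?_
      rw [mul_comm (Real.exp 1), ← nsmul_eq_mul]
      refine Finset.sum_le_card_nsmul _ _ _ fun u _ => ?_
      rw [Finset.sum_singleton, Real.exp_le_exp]
      have := hyle K v hK τ t u
      have : 0 ≤ (1 + 4 * β) * (1 + β) * wt τ t := mul_nonneg (by positivity) (hwt τ t)
      linarith
    · obtain ⟨x, hx, hmax⟩ := Finset.exists_max_image (P.erase t) rk hne
      obtain ⟨hxt, hxP⟩ := Finset.mem_erase.mp hx
      have hcard : (P.erase x).card = n := by
        rw [Finset.card_erase_of_mem hxP]; omega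
      obtain ⟨φ, K, h1, h2, h3, h4, h5, h6⟩ := ih (P.erase x)
        (Finset.mem_erase.mpr ⟨hxt.symm, htP⟩)
        (fun y hy hyt => by
          obtain ⟨hyx, hyP⟩ := Finset.mem_erase.mp hy
          obtain ⟨a1, a2⟩ := hpar y hyP hyt
          refine ⟨Finset.mem_erase.mpr ⟨fun h => ?_, a1⟩, a2⟩
          have := hmax y (Finset.mem_erase.mpr ⟨hyt, hyP⟩)
          rw [h] at a2
          omega)
        (le_trans (by exact_mod_cast Finset.card_le_card (Finset.erase_subset _ _)) hPR) hcard
      obtain ⟨hpx, hrx⟩ := hpar x hxP hxt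
      have hpx' : par x ∈ P.erase x := Finset.mem_erase.mpr
        ⟨fun h => by rw [h] at hrx; omega, hpx⟩
      set Q : Finset V := (dirNbr D (dir x) (φ (par x)) ∩ R) \ (P.erase x).image φ with hQdef
      have hQR : Q ⊆ R := Finset.sdiff_subset.trans Finset.inter_subset_right
      -- Two neighbourhoods, each of more than half of `R`, share at least `α * |R|` vertices; at
      -- most `α / 2 * |R|` of these are already used.
      have hdQ : ∀ s, ∀ u ∈ U s, α / 2 * R.card ≤ ((dirNbr D (!s) u ∩ Q).card : ℝ) := by
        intro s u _
        have e1 := hdR (dir x) (φ (par x))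
        have e2 := hdR (!s) u
        have e3 : ((P.erase x).image φ).card ≤ P.card :=
          Finset.card_image_le.trans (Finset.card_le_card (Finset.erase_subset _ _))
        have e4 : (dirNbr D (dir x) (φ (par x)) ∩ R).card + (dirNbr D (!s) u ∩ R).card
            ≤ R.card + ((dirNbr D (!s) u ∩ Q).card + P.card) := by
          have f1 := Finset.card_union_add_card_inter (dirNbr D (dir x) (φ (par x)) ∩ R)
            (dirNbr D (!s) u ∩ R)
          have f2 := Finset.card_le_card (Finset.union_subset
            (Finset.inter_subset_right (s₁ := dirNbr D (dir x) (φ (par x))) (s₂ := R))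
            (Finset.inter_subset_right (s₁ := dirNbr D (!s) u) (s₂ := R)))
          have f3 : (dirNbr D (dir x) (φ (par x)) ∩ R) ∩ (dirNbr D (!s) u ∩ R)
              ⊆ (dirNbr D (!s) u ∩ Q) ∪ (P.erase x).image φ := by
            intro z hz
            simp only [hQdef, Finset.mem_inter, Finset.mem_union, Finset.mem_sdiff] at hz ⊢
            tauto
          have f4 := (Finset.card_le_card f3).trans (Finset.card_union_le _ _)
          omega
        have e5 : ((dirNbr D (dir x) (φ (par x)) ∩ R).card : ℝ) + (dirNbr D (!s) u ∩ R).card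
            ≤ R.card + ((dirNbr D (!s) u ∩ Q).card + P.card) := by exact_mod_cast e4
        linarith
      set h : J → V → ℝ := fun τ u => Real.exp (∑ x ∈ P.erase x,
        (wt τ x * (U (sg τ)).card * K x (sg τ) u - (1 + 4 * β) * (1 + β) * wt τ x)) with hh
      -- The price of `u` is the derivative of the discounted potential with respect to the kernel
      -- at `u`, up to the factor `1 + β` from linearising the exponential.
      obtain ⟨w, hwQ, Kx, hKx, hcost⟩ := exists_cheap_nbrKernel D Q U
        (fun s u => ∑ τ, if sg τ = s then
          Real.exp (-((1 + 4 * β) * (1 + β) * wt τ x)) * ((1 + β) * wt τ x * (U s).card) * h τ u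
          else 0)
        (fun s u => Finset.sum_nonneg fun τ _ => by
          split_ifs
          · exact mul_nonneg (mul_nonneg (Real.exp_pos _).le (mul_nonneg (mul_nonneg
              (by positivity) (hwt τ x)) (hUpos s).le)) (Real.exp_pos _).le
          · exact le_rfl)
        (a := α / 2) (β := β) (r := R.card) (by positivity) hβ0 hβ
        (by have := hRpos.card_pos; positivity) (by exact_mod_cast Finset.card_le_card hQR)
        hβU haU hdQ (fun s w _ => hdU s w)
      have hpot := sum_exp_potential_le U sg (fun τ => wt τ x) h
        (fun τ u => (Real.exp_pos _).le) Kx hβ0.le (by linarith) hUpos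
        (fun τ u => hy0 Kx w hKx τ x u) (fun τ u => hyle Kx w hKx τ x u) hcost
      rw [hQdef, Finset.mem_sdiff, Finset.mem_inter, mem_dirNbr] at hwQ
      obtain ⟨⟨hw1, hw2⟩, hw3⟩ := hwQ
      have hupd : ∀ y ∈ P, y ≠ x → Function.update φ x w y = φ y ∧
          Function.update K x Kx y = K y := fun y _ hyx =>
        ⟨Function.update_of_ne hyx _ _, Function.update_of_ne hyx _ _⟩
      refine ⟨Function.update φ x w, Function.update K x Kx, ?_, ?_, ?_, ?_, ?_, ?_⟩
      · rw [Function.update_of_ne hxt.symm, h1]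
      · have key : ∀ y ∈ P, y ≠ x → φ y ≠ w := fun y hy hyx he =>
          hw3 (Finset.mem_image.mpr ⟨y, Finset.mem_erase.mpr ⟨hyx, hy⟩, he⟩)
        intro y hy z hz hyz
        by_cases hyx : y = x <;> by_cases hzx : z = x
        · rw [hyx, hzx]
        · rw [hyx, Function.update_self, (hupd z hz hzx).1] at hyz
          exact absurd hyz.symm (key z hz hzx)
        · rw [hzx, Function.update_self, (hupd y hy hyx).1] at hyz
          exact absurd hyz (key y hy hyx)
        · rw [(hupd y hy hyx).1, (hupd z hz hzx).1] at hyz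
          exact h2 (Finset.mem_coe.mpr (Finset.mem_erase.mpr ⟨hyx, hy⟩))
            (Finset.mem_coe.mpr (Finset.mem_erase.mpr ⟨hzx, hz⟩)) hyz
      · intro y hy hyt
        by_cases hyx : y = x
        · rw [hyx, Function.update_self]; exact hw2
        · rw [(hupd y hy hyx).1]; exact h3 y (Finset.mem_erase.mpr ⟨hyx, hy⟩) hyt
      · intro y hy hyt
        by_cases hyx : y = x
        · rw [hyx, Function.update_self, (hupd _ hpx (Finset.mem_erase.mp hpx').1).1]
          exact hw1
        · obtain ⟨a1, a2⟩ := hpar y hy hyt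
          have hpy : par y ≠ x := fun h => by
            have := hmax y (Finset.mem_erase.mpr ⟨hyt, hy⟩)
            rw [h] at a2
            omega
          rw [(hupd y hy hyx).1, (hupd _ a1 hpy).1]
          exact h4 y (Finset.mem_erase.mpr ⟨hyx, hy⟩) hyt
      · intro y hy
        by_cases hyx : y = x
        · rw [hyx, Function.update_self, Function.update_self]; exact hKx
        · rw [(hupd y hy hyx).1, (hupd y hy hyx).2]
          exact h5 y (Finset.mem_erase.mpr ⟨hyx, hy⟩)
      · refine le_trans (le_of_eq ?_) (hpot.trans h6)
        refine Finset.sum_congr rfl fun τ _ => Finset.sum_congr rfl fun u _ => ?_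
        rw [hh, ← Real.exp_add, ← Finset.sum_erase_add P _ hxP, Function.update_self]
        congr 2
        refine Finset.sum_congr rfl fun y hy => ?_
        obtain ⟨hyx, hyP⟩ := Finset.mem_erase.mp hy
        rw [(hupd y hyP hyx).2]

end DigraphTrees

/-! ### Enumerating and rooting the tree -/

/-- Search order from `r`: as long as vertices are missing, a walk from `r` to a missing one leaves
the enumerated set along some edge, whose far end comes next. -/
theorem SimpleGraph.exists_enumeration_of_connected {W : Type*} [Finite W] (G : SimpleGraph W)
    (A : Set W) (hA : (G.induce A).Connected) {r : W} (hr : r ∈ A) :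
    ∃ (e : ℕ → W) (p : ℕ → ℕ) (idx : W → ℕ), e 0 = r ∧
      (∀ j < A.ncard, e j ∈ A ∧ idx (e j) = j) ∧
      (∀ x ∈ A, idx x < A.ncard ∧ e (idx x) = x) ∧
      ∀ j, 0 < j → j < A.ncard → p j < j ∧ G.Adj (e (p j)) (e j) := by
  classical
  have hfin : A.Finite := A.toFinite
  have grow : ∀ m, 0 < m → m ≤ A.ncard → ∃ (e : ℕ → W) (p : ℕ → ℕ), e 0 = r ∧
      (∀ j < m, e j ∈ A) ∧ Set.InjOn e (Set.Iio m) ∧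
      ∀ j, 0 < j → j < m → p j < j ∧ G.Adj (e (p j)) (e j) := by
    intro m hm
    induction m, hm using Nat.le_induction with
    | base =>
      intro _
      refine ⟨fun _ => r, fun _ => 0, rfl, fun _ _ => hr, ?_, fun j h1 h2 => by omega⟩
      intro a ha b hb _
      simp only [Set.mem_Iio] at ha hb
      omega
    | succ m hm ih =>
      intro hmA
      obtain ⟨e, p, h0, h1, h2, h3⟩ := ih (by omega)
      have hcard : (e '' Set.Iio m).ncard = m := by
        rw [h2.ncard_image]; simp
      have hsub : e '' Set.Iio m ⊆ A := by
        rintro _ ⟨j, hj, rfl⟩; exact h1 j hj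
      obtain ⟨z, hzA, hz⟩ : ∃ z ∈ A, z ∉ e '' Set.Iio m := by
        by_contra hcon
        push Not at hcon
        have := Set.ncard_le_ncard hcon ((Set.finite_Iio m).image e)
        omega
      obtain ⟨q⟩ := hA.preconnected ⟨r, hr⟩ ⟨z, hzA⟩
      obtain ⟨d, -, hd1, hd2⟩ := q.exists_boundary_dart {x | (x : W) ∈ e '' Set.Iio m}
        ⟨0, Set.mem_Iio.mpr hm, h0⟩ hz
      obtain ⟨i, hi, hie⟩ := hd1
      have hadj : G.Adj d.fst d.snd := d.adj
      simp only [Set.mem_Iio] at hi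
      refine ⟨Function.update e m d.snd, Function.update p m i, ?_, ?_, ?_, ?_⟩
      · rw [Function.update_of_ne (by omega), h0]
      · intro j hj
        rcases Nat.lt_succ_iff_lt_or_eq.mp hj with hj | rfl
        · rw [Function.update_of_ne hj.ne]; exact h1 j hj
        · rw [Function.update_self]; exact d.snd.2
      · intro a ha b hb hab
        simp only [Set.mem_Iio] at ha hb
        rcases Nat.lt_succ_iff_lt_or_eq.mp ha with ha | rfl <;>
          rcases Nat.lt_succ_iff_lt_or_eq.mp hb with hb | rfl
        · rw [Function.update_of_ne ha.ne, Function.update_of_ne hb.ne] at hab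
          exact h2 ha hb hab
        · rw [Function.update_of_ne ha.ne, Function.update_self] at hab
          exact absurd ⟨a, ha, hab⟩ hd2
        · rw [Function.update_of_ne hb.ne, Function.update_self] at hab
          exact absurd ⟨b, hb, hab.symm⟩ hd2
        · rfl
      · intro j hj0 hj
        rcases Nat.lt_succ_iff_lt_or_eq.mp hj with hj | rfl
        · obtain ⟨a1, a2⟩ := h3 j hj0 hj
          rw [Function.update_of_ne hj.ne, Function.update_of_ne hj.ne,
            Function.update_of_ne (by omega)]
          exact ⟨a1, a2⟩
        · rw [Function.update_self, Function.update_self, Function.update_of_ne (by omega), hie]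
          exact ⟨hi, hadj⟩
  have hpos : 0 < A.ncard := (Set.ncard_pos hfin).mpr ⟨r, hr⟩
  obtain ⟨e, p, h0, h1, h2, h3⟩ := grow A.ncard hpos le_rfl
  have himg : e '' Set.Iio A.ncard = A := by
    refine Set.eq_of_subset_of_ncard_le ?_ ?_ hfin
    · rintro _ ⟨j, hj, rfl⟩; exact h1 j hj
    · rw [h2.ncard_image]; simp
  refine ⟨e, p, Function.invFunOn e (Set.Iio A.ncard), h0, fun j hj => ⟨h1 j hj, ?_⟩,
    fun x hx => ?_, h3⟩
  · exact h2.leftInvOn_invFunOn hj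
  · rw [← himg] at hx
    exact ⟨Function.invFunOn_mem hx, Function.invFunOn_eq hx⟩

/-- The parent edges are distinct because ranks decrease, so there are `|W| - 1` of them. A tree has
no further edges. -/
theorem SimpleGraph.IsTree.eq_parent_of_adj {W : Type*} [Finite W] {G : SimpleGraph W}
    (hG : G.IsTree) (t : W) (par : W → W) (rk : W → ℕ) (hadj : ∀ x, x ≠ t → G.Adj (par x) x)
    (hrk : ∀ x, x ≠ t → rk (par x) < rk x) {a b : W} (hab : G.Adj a b) :
    (b ≠ t ∧ a = par b) ∨ (a ≠ t ∧ b = par a) := by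
  classical
  have := Fintype.ofFinite W
  have hinj : Set.InjOn (fun x => s(par x, x)) ((Finset.univ.erase t : Finset W) : Set W) := by
    intro x hx y hy hxy
    simp only [Finset.coe_erase, Finset.coe_univ, Set.mem_sdiff, Set.mem_univ, true_and,
      Set.mem_singleton_iff] at hx hy
    rcases Sym2.eq_iff.mp hxy with ⟨-, h⟩ | ⟨h1, h2⟩
    · exact h
    · have h3 := hrk x hx
      have h4 := hrk y hy
      rw [h1] at h3
      rw [← h2] at h4
      omega
  have hsub : (Finset.univ.erase t).image (fun x => s(par x, x)) ⊆ G.edgeFinset := by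
    intro z hz
    obtain ⟨x, hx, rfl⟩ := Finset.mem_image.mp hz
    rw [SimpleGraph.mem_edgeFinset, SimpleGraph.mem_edgeSet]
    exact hadj x (Finset.ne_of_mem_erase hx)
  have heq := Finset.eq_of_subset_of_card_le hsub (by
    rw [Finset.card_image_of_injOn hinj, Finset.card_erase_of_mem (Finset.mem_univ _),
      Finset.card_univ]
    have := hG.card_edgeFinset
    omega)
  have hmem : s(a, b) ∈ G.edgeFinset := by
    rw [SimpleGraph.mem_edgeFinset, SimpleGraph.mem_edgeSet]; exact hab
  rw [← heq] at hmem
  obtain ⟨x, hx, hxe⟩ := Finset.mem_image.mp hmem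
  have hxt := Finset.ne_of_mem_erase hx
  rcases Sym2.eq_iff.mp hxe with ⟨h1, rfl⟩ | ⟨h1, rfl⟩
  · exact Or.inl ⟨hxt, h1.symm⟩
  · exact Or.inr ⟨hxt, h1.symm⟩

namespace DigraphTrees

/-- A rooted description of an oriented tree formed by attaching subtrees: parents `par` towards
the root `t`, and for each attached subtree an enumeration `e i` of its `k i` vertices in which
the parent of `e i j` is `e i (p i j)`. -/
structure RootedAttaching {W : Type*} (T : Digraph W) (T' : Set W) {ℓ : ℕ} (S : Fin ℓ → Set W)
    (t : W) (par : W → W) (rk : W → ℕ) (e : Fin ℓ → ℕ → W) (p : Fin ℓ → ℕ → ℕ)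
    (idx : Fin ℓ → W → ℕ) : Prop where
  rk_lt : ∀ x, x ≠ t → rk (par x) < rk x
  eq_par : ∀ a b, T.Adj a b → (b ≠ t ∧ a = par b) ∨ (a ≠ t ∧ b = par a)
  adj_par : ∀ x, x ≠ t → T.Adj (par x) x ∨ T.Adj x (par x)
  par_core : ∀ x ∈ T', x ≠ t → par x ∈ T'
  pos : ∀ i, 0 < (S i).ncard
  enum_mem : ∀ i, ∀ j < (S i).ncard, e i j ∈ S i ∧ idx i (e i j) = j
  idx_lt : ∀ i, ∀ x ∈ S i, idx i x < (S i).ncard ∧ e i (idx i x) = x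
  par_root : ∀ i, par (e i 0) ∈ T'
  par_enum : ∀ i j, 0 < j → j < (S i).ncard → p i j < j ∧ par (e i j) = e i (p i j)

theorem IsFormedByAttaching.exists_rootedAttaching {W : Type*} [Finite W] {T : Digraph W}
    {T' : Set W} {ℓ : ℕ} {S : Fin ℓ → Set W} (hT : IsOrientedTree T)
    (h : IsFormedByAttaching T T' S) {t : W} (ht : t ∈ T') :
    ∃ par rk e p idx, RootedAttaching T T' S t par rk e p idx := by
  classical
  set G := T.toSimpleGraphInclusive with hG
  have hGadj : ∀ a b, T.Adj a b → G.Adj a b := fun a b hab => by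
    refine ⟨fun hne => ?_, Or.inl hab⟩
    subst hne
    exact hT.asymm _ _ hab hab
  obtain ⟨e', p', idx', h0, h1, h2, h3⟩ :=
    G.exists_enumeration_of_connected T' h.subtree_core.1 ht
  have hroot : ∀ i, ∃ x ∈ T', ∃ r ∈ S i, G.Adj x r := by
    intro i
    obtain ⟨⟨a, b⟩, ⟨hab, hor⟩, -⟩ := h.attaching_edge i
    rcases hor with ⟨ha, hb⟩ | ⟨ha, hb⟩
    · exact ⟨a, ha, b, hb, hGadj _ _ hab⟩
    · exact ⟨b, hb, a, ha, (hGadj _ _ hab).symm⟩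
  choose att hatt r hr hadj using hroot
  choose e p idx g0 g1 g2 g3 using fun i =>
    G.exists_enumeration_of_connected (S i) (h.subtree_attached i).1 (hr i)
  have hcov : ∀ x, x ∉ T' → ∃ i, x ∈ S i := fun x hx => by
    have := h.cover.symm ▸ Set.mem_univ x
    rcases this with h | h
    · exact absurd h hx
    · simpa using h
  have huniq : ∀ i j x, x ∈ S i → x ∈ S j → i = j := fun i j x hi hj => by
    by_contra hne
    exact Set.disjoint_left.mp (h.disjoint_attached i j hne) hi hj
  have hnot : ∀ i x, x ∈ S i → x ∉ T' := fun i x hi hx =>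
    Set.disjoint_left.mp (h.disjoint_core i) hx hi
  set ci : {x // x ∉ T'} → Fin ℓ := fun x => (hcov x.1 x.2).choose with hci
  have hcs : ∀ x, x.1 ∈ S (ci x) := fun x => (hcov x.1 x.2).choose_spec
  have hci_eq : ∀ i x (hx : x ∈ S i), ci ⟨x, hnot i x hx⟩ = i := fun i x hx =>
    huniq _ _ x (hcs ⟨x, _⟩) hx
  set par : W → W := fun x => if hx : x ∈ T' then e' (p' (idx' x)) else
    if idx (ci ⟨x, hx⟩) x = 0 then att (ci ⟨x, hx⟩)
    else e (ci ⟨x, hx⟩) (p (ci ⟨x, hx⟩) (idx (ci ⟨x, hx⟩) x)) with hpar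
  -- The shift by `T'.ncard` puts every attached vertex after the whole core, so that ranks also
  -- decrease along the attaching edges.
  set rk : W → ℕ := fun x => if hx : x ∈ T' then idx' x else
    T'.ncard + idx (ci ⟨x, hx⟩) x with hrkdef
  have parT : ∀ x ∈ T', par x = e' (p' (idx' x)) := fun x hx => by simp only [hpar, dif_pos hx]
  have parS : ∀ i, ∀ x ∈ S i, par x = if idx i x = 0 then att i else e i (p i (idx i x)) :=
    fun i x hx => by simp only [hpar, dif_neg (hnot i x hx), hci_eq i x hx]
  have rkT : ∀ x ∈ T', rk x = idx' x := fun x hx => by simp only [hrkdef, dif_pos hx]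
  have rkS : ∀ i, ∀ x ∈ S i, rk x = T'.ncard + idx i x :=
    fun i x hx => by simp only [hrkdef, dif_neg (hnot i x hx), hci_eq i x hx]
  have ncard_pos : ∀ i, 0 < (S i).ncard := fun i =>
    (Set.ncard_pos (Set.toFinite _)).mpr ⟨r i, hr i⟩
  have idx0 : ∀ x ∈ T', x ≠ t → 0 < idx' x := fun x hx hxt => by
    rw [Nat.pos_iff_ne_zero]
    intro h00
    have := (h2 x hx).2
    rw [h00, h0] at this
    exact hxt this.symm
  have parTmem : ∀ x ∈ T', x ≠ t → par x ∈ T' := fun x hx hxt => by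
    rw [parT x hx]
    have a1 := (h2 x hx).1
    have a2 := (h3 _ (idx0 x hx hxt) a1).1
    exact (h1 _ (by omega)).1
  have idxe0 : ∀ i, ∀ x ∈ S i, idx i x = 0 → x = r i := fun i x hx hi => by
    have := (g2 i x hx).2
    rw [hi, g0] at this
    exact this.symm
  have hmain : ∀ x, x ≠ t → G.Adj (par x) x ∧ rk (par x) < rk x := by
    intro x hxt
    by_cases hx : x ∈ T'
    · have a1 := h2 x hx
      have a2 := h3 _ (idx0 x hx hxt) a1.1
      rw [rkT x hx, rkT _ (parTmem x hx hxt), parT x hx, (h1 _ (by omega)).2]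
      rw [a1.2] at a2
      exact ⟨a2.2, a2.1⟩
    · obtain ⟨i, hi⟩ := hcov x hx
      have a1 := g2 i x hi
      rw [rkS i x hi, parS i x hi]
      split_ifs with h00
      · rw [rkT _ (hatt i), h00]
        have := idxe0 i x hi h00
        exact ⟨this ▸ hadj i, by have := (h2 _ (hatt i)).1; omega⟩
      · have a2 := g3 i _ (Nat.pos_of_ne_zero h00) a1.1
        have a3 := g1 i (p i (idx i x)) (by omega)
        rw [rkS i _ a3.1, a3.2]
        rw [a1.2] at a2
        exact ⟨a2.2, by omega⟩
  refine ⟨par, rk, e, p, idx, fun x hx => (hmain x hx).2, fun a b hab => ?_, fun x hx => ?_,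
    parTmem, ncard_pos, g1, g2, fun i => ?_, fun i j hj0 hj => ?_⟩
  · exact hT.isTree.eq_parent_of_adj t par rk (fun x hx => (hmain x hx).1)
      (fun x hx => (hmain x hx).2) (hGadj a b hab)
  · exact (hmain x hx).1.2
  · have a1 := g1 i 0 (ncard_pos i)
    rw [parS i _ a1.1, if_pos a1.2]
    exact hatt i
  · have a1 := g1 i j hj
    rw [parS i _ a1.1, a1.2, if_neg (by omega)]
    exact ⟨(g3 i j hj0 hj).1, rfl⟩

end DigraphTrees

/-! ### Splitting the host and gluing embeddings -/

namespace DigraphTrees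

/-- A balanced colouring of a vertex set `A` that splits all neighbourhoods proportionally. -/
theorem exists_coloring_dirNbr {V ι J : Type*} [Fintype V] [DecidableEq V] [Fintype ι]
    [DecidableEq ι] [Fintype J] (D : Digraph V) (A : Finset V) (p : ι → ℝ) (hp0 : ∀ i, 0 ≤ p i)
    (hp1 : ∑ i, p i = 1) (f : J → V → ℝ) (hf0 : ∀ j a, 0 ≤ f j a) (hf1 : ∀ j a, f j a ≤ 1)
    {δ m : ℝ} (hδ0 : 0 < δ) (hδ1 : δ ≤ 1) (hA : (A.card : ℝ) ≤ m)
    (hm : Real.log (Fintype.card ι * (2 + 2 * Fintype.card V + Fintype.card J)) ≤ δ ^ 2 * m / 4) :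
    ∃ χ : V → ι, ∀ i,
      (A.filter (χ · = i)).card ≤ p i * A.card + δ * m ∧
      p i * A.card - δ * m ≤ (A.filter (χ · = i)).card ∧
      (∀ s a, p i * (dirNbr D s a ∩ A).card - δ * m
        ≤ (dirNbr D s a ∩ A.filter (χ · = i)).card) ∧
      ∀ j, p i * ∑ a ∈ A, f j a - δ * m ≤ ∑ a ∈ A with χ a = i, f j a := by
  -- Balanced colourings give lower bounds only; the constant weighting `-1` is included to bound
  -- the class sizes from above.
  obtain ⟨χ, hχ⟩ := exists_balanced_coloring (J := Bool ⊕ (Bool × V) ⊕ J) A p hp0 hp1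
    (Sum.elim (fun b _ => if b then 1 else -1)
      (Sum.elim (fun q a => if a ∈ dirNbr D q.1 q.2 then 1 else 0) f))
    (by
      rintro (b | q | j) a
      · cases b <;> simp
      · simp only [Sum.elim_inr, Sum.elim_inl]; split_ifs <;> simp
      · simp only [Sum.elim_inr]; rw [abs_of_nonneg (hf0 j a)]; exact hf1 j a)
    hδ0 hδ1 hA (by
      refine le_trans (le_of_eq ?_) hm
      simp only [Fintype.card_sum, Fintype.card_prod, Fintype.card_bool]
      push_cast
      ring_nf)
  refine ⟨χ, fun i => ⟨?_, ?_, fun s a => ?_, fun j => ?_⟩⟩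
  · have := hχ i (Sum.inl false)
    simp at this
    linarith
  · have := hχ i (Sum.inl true)
    simpa using this
  · have := hχ i (Sum.inr (Sum.inl (s, a)))
    simp only [Sum.elim_inr, Sum.elim_inl, Finset.sum_boole, Finset.filter_mem_eq_inter] at this
    rwa [Finset.inter_comm A, Finset.inter_comm (A.filter _)] at this
  · exact hχ i (Sum.inr (Sum.inr j))

open Classical in
/-- The direction of the edge between a vertex and its parent (`true` if away from the
parent). -/
noncomputable def parDir {W : Type*} (T : Digraph W) (par : W → W) (x : W) : Bool :=
  decide (T.Adj (par x) x)

/-- Gluing an embedding of the core with embeddings of the attached subtrees. -/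
theorem RootedAttaching.containsCopyAt {V W : Type*} {D : Digraph V} {T : Digraph W} {T' : Set W}
    {ℓ : ℕ} {S : Fin ℓ → Set W} {t : W} {par : W → W} {rk : W → ℕ} {e : Fin ℓ → ℕ → W}
    {p : Fin ℓ → ℕ → ℕ} {idx : Fin ℓ → W → ℕ}
    (hR : RootedAttaching T T' S t par rk e p idx) (hT : IsOrientedTree T)
    (h : IsFormedByAttaching T T' S) (ht : t ∈ T') (big : Fin ℓ → Prop) (C : Set W)
    (hC : ∀ x, x ∈ C ↔ x ∈ T' ∨ ∃ i, ¬ big i ∧ x ∈ S i) (v : V) (φ : W → V) (hφt : φ t = v)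
    (hφ : Set.InjOn φ C)
    (hφe : ∀ x ∈ C, x ≠ t → DirAdj D (parDir T par x) (φ (par x)) (φ x))
    (ψ : Fin ℓ → ℕ → V)
    (hψ : ∀ i, big i → ∀ j < (S i).ncard, ∀ i', big i' → ∀ j' < (S i').ncard,
      ψ i j = ψ i' j' → i = i' ∧ j = j')
    (hψφ : ∀ i, big i → ∀ j < (S i).ncard, ∀ x ∈ C, ψ i j ≠ φ x)
    (hψ0 : ∀ i, big i → DirAdj D (parDir T par (e i 0)) (φ (par (e i 0))) (ψ i 0))
    (hψe : ∀ i, big i → ∀ j, 0 < j → j < (S i).ncard →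
      DirAdj D (parDir T par (e i j)) (ψ i (p i j)) (ψ i j)) :
    ContainsCopyAt D T t v := by
  classical
  have hcov : ∀ x, x ∉ C → ∃ i, big i ∧ x ∈ S i := fun x hx => by
    rw [hC] at hx
    push Not at hx
    have := h.cover.symm ▸ Set.mem_univ x
    rcases this with h' | h'
    · exact absurd h' hx.1
    · obtain ⟨i, hi⟩ := Set.mem_iUnion.mp h'
      exact ⟨i, by_contra fun hb => hx.2 i hb hi, hi⟩
  have huniq : ∀ i j x, x ∈ S i → x ∈ S j → i = j := fun i j x hi hj => by
    by_contra hne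
    exact Set.disjoint_left.mp (h.disjoint_attached i j hne) hi hj
  have hnot : ∀ i x, big i → x ∈ S i → x ∉ C := fun i x hb hi hx => by
    rcases (hC x).mp hx with hx | ⟨j, hj, hx⟩
    · exact Set.disjoint_left.mp (h.disjoint_core i) hx hi
    · exact hj (huniq i j x hi hx ▸ hb)
  have htC : t ∈ C := (hC t).mpr (Or.inl ht)
  set Φ : W → V := fun x => if hx : x ∈ C then φ x else
    ψ (hcov x hx).choose (idx (hcov x hx).choose x) with hΦ
  have ΦC : ∀ x ∈ C, Φ x = φ x := fun x hx => by simp only [hΦ, dif_pos hx]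
  have ΦS : ∀ i, big i → ∀ x ∈ S i, Φ x = ψ i (idx i x) := fun i hb x hx => by
    have hxC := hnot i x hb hx
    have : (hcov x hxC).choose = i := huniq _ _ x (hcov x hxC).choose_spec.2 hx
    simp only [hΦ, dif_neg hxC, this]
  have hedge : ∀ x, x ≠ t → DirAdj D (parDir T par x) (Φ (par x)) (Φ x) := by
    intro x hxt
    by_cases hx : x ∈ C
    · have hpC : par x ∈ C := by
        rcases (hC x).mp hx with hx' | ⟨i, hi, hx'⟩
        · exact (hC _).mpr (Or.inl (hR.par_core x hx' hxt))
        · have a1 := hR.idx_lt i x hx'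
          rcases Nat.eq_zero_or_pos (idx i x) with h0 | h0
          · have a2 := hR.par_root i
            rw [← h0, a1.2] at a2
            exact (hC _).mpr (Or.inl a2)
          · have a2 := hR.par_enum i _ h0 a1.1
            rw [a1.2] at a2
            rw [a2.2]
            exact (hC _).mpr (Or.inr ⟨i, hi, (hR.enum_mem i _ (by omega)).1⟩)
      rw [ΦC x hx, ΦC _ hpC]
      exact hφe x hx hxt
    · obtain ⟨i, hb, hi⟩ := hcov x hx
      have a1 := hR.idx_lt i x hi
      rw [ΦS i hb x hi]
      rcases Nat.eq_zero_or_pos (idx i x) with h0 | h0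
      · have hxe : e i 0 = x := by rw [← h0, a1.2]
        have a2 := hψ0 i hb
        rw [hxe] at a2
        rw [h0, ΦC]
        · exact a2
        · have := hR.par_root i
          rw [hxe] at this
          exact (hC _).mpr (Or.inl this)
      · have a2 := hR.par_enum i _ h0 a1.1
        have a3 := hψe i hb _ h0 a1.1
        rw [a1.2] at a2 a3
        have a4 := hR.enum_mem i (p i (idx i x)) (by omega)
        rw [a2.2, ΦS i hb _ a4.1, a4.2]
        exact a3
  refine ⟨Φ, ?_, ?_, by rw [ΦC t htC, hφt]⟩
  · intro x y hxy
    by_cases hx : x ∈ C <;> by_cases hy : y ∈ C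
    · rw [ΦC x hx, ΦC y hy] at hxy
      exact hφ hx hy hxy
    · obtain ⟨i, hb, hi⟩ := hcov y hy
      rw [ΦC x hx, ΦS i hb y hi] at hxy
      exact absurd hxy.symm (hψφ i hb _ (hR.idx_lt i y hi).1 x hx)
    · obtain ⟨i, hb, hi⟩ := hcov x hx
      rw [ΦC y hy, ΦS i hb x hi] at hxy
      exact absurd hxy (hψφ i hb _ (hR.idx_lt i x hi).1 y hy)
    · obtain ⟨i, hb, hi⟩ := hcov x hx
      obtain ⟨i', hb', hi'⟩ := hcov y hy
      rw [ΦS i hb x hi, ΦS i' hb' y hi'] at hxy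
      obtain ⟨rfl, hj⟩ := hψ i hb _ (hR.idx_lt i x hi).1 i' hb' _ (hR.idx_lt i' y hi').1 hxy
      rw [← (hR.idx_lt i x hi).2, ← (hR.idx_lt i y hi').2, hj]
  · intro a b hab
    rcases hR.eq_par a b hab with ⟨hb, rfl⟩ | ⟨ha, rfl⟩
    · have := hedge b hb
      rwa [show parDir T par b = true by simp [parDir, hab]] at this
    · have := hedge a ha
      rwa [show parDir T par a = false by simp [parDir, hT.asymm _ _ hab]] at this

end DigraphTrees

namespace DigraphTrees

/-- Splitting the vertices other than `v` of a digraph of large minimum semidegree. -/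
theorem exists_host_partition {V ι : Type*} [Fintype V] [DecidableEq V] [Fintype ι]
    [DecidableEq ι] (D : Digraph V) (v : V) {α δ : ℝ}
    (hdeg : ∀ s a, (1 / 2 + α) * Fintype.card V ≤ (dirNbr D s a).card)
    (p : ι → ℝ) (hp0 : ∀ i, 0 ≤ p i) (hp1 : ∑ i, p i = 1) (hδ0 : 0 < δ) (hδ1 : δ ≤ 1)
    (hδn : 1 ≤ δ * Fintype.card V)
    (hlog : Real.log (Fintype.card ι * (2 + 2 * Fintype.card V)) ≤ δ ^ 2 * Fintype.card V / 4) :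
    ∃ P : ι → Finset V, (∀ i, v ∉ P i) ∧ (∀ i j, i ≠ j → Disjoint (P i) (P j)) ∧
      ∀ i, (P i).card ≤ p i * Fintype.card V + 2 * δ * Fintype.card V ∧
        p i * Fintype.card V - 2 * δ * Fintype.card V ≤ (P i).card ∧
        ∀ s a, p i * ((1 / 2 + α) * Fintype.card V) - 2 * δ * Fintype.card V
          ≤ (dirNbr D s a ∩ P i).card := by
  set n : ℝ := (Fintype.card V : ℝ) with hn
  have hple : ∀ i, p i ≤ 1 := fun i =>
    hp1 ▸ Finset.single_le_sum (fun i _ => hp0 i) (Finset.mem_univ i)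
  have hAc : ((Finset.univ.erase v : Finset V).card : ℝ) = n - 1 := by
    rw [Finset.card_erase_of_mem (Finset.mem_univ v), Finset.card_univ,
      Nat.cast_pred (Fintype.card_pos_iff.mpr ⟨v⟩)]
  obtain ⟨χ, hχ⟩ := exists_coloring_dirNbr (J := Empty) D (Finset.univ.erase v) p hp0 hp1
    (fun j => j.elim) (fun j => j.elim) (fun j => j.elim) hδ0 hδ1 (m := n) (by linarith)
    (by simpa using hlog)
  refine ⟨fun i => (Finset.univ.erase v).filter (χ · = i), fun i => by simp, fun i j hij => ?_,
    fun i => ?_⟩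
  · rw [Finset.disjoint_left]
    intro a ha hb
    exact hij ((Finset.mem_filter.mp ha).2.symm.trans (Finset.mem_filter.mp hb).2)
  · obtain ⟨h1, h2, h3, -⟩ := hχ i
    rw [hAc] at h1 h2
    have hp := hple i
    have hp' := hp0 i
    refine ⟨by nlinarith, by nlinarith, fun s a => ?_⟩
    have h4 := h3 s a
    -- Leaving out `v` costs one vertex, which the second `δ * n` of the error absorbs.
    have h5 : (dirNbr D s a).card ≤ (dirNbr D s a ∩ Finset.univ.erase v).card + 1 := by
      have : dirNbr D s a ∩ Finset.univ.erase v = (dirNbr D s a).erase v := by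
        ext; simp [and_comm]
      rw [this]
      have := Finset.pred_card_le_card_erase (s := dirNbr D s a) (a := v)
      omega
    have h6 : ((dirNbr D s a).card : ℝ) ≤ (dirNbr D s a ∩ Finset.univ.erase v).card + 1 := by
      exact_mod_cast h5
    have h7 := hdeg s a
    have h8 : p i * ((1 / 2 + α) * n) ≤ p i * ((dirNbr D s a ∩ Finset.univ.erase v).card + 1) :=
      mul_le_mul_of_nonneg_left (h7.trans h6) hp'
    linarith

/-- Choosing the roots of the attached subtrees in `U` from evenly spread kernels, those of each
type `τ` within a set `B τ` that all neighbourhoods meet proportionally. -/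
theorem exists_root_matching {V W J X : Type*} [Fintype V] [DecidableEq V] [Fintype W]
    [Fintype J] [DecidableEq J] [Fintype X] (D : Digraph V) (U : Finset V) (hU : U.Nonempty)
    (ty : X → J) (px : X → W) (κ : W → V → ℝ) (good : Finset J) {α δ η γ c : ℝ}
    (hc : 0 < c) (hκ0 : ∀ x u, 0 ≤ κ x u) (hκ1 : ∀ x u, κ x u ≤ c / U.card)
    (hκs : ∀ y, ty y ∈ good → ∑ u ∈ U, κ (px y) u = 1)
    (hdU : ∀ s a, (1 / 2 + α / 2) * U.card ≤ (dirNbr D s a ∩ U).card)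
    (hδ0 : 0 < δ) (hδ1 : δ ≤ 1) (hη : 0 ≤ η) (hγ : 0 < γ) (hδc : δ * c ≤ η * γ)
    (N : J → ℕ) (hN : ∀ τ ∈ good, γ * Fintype.card V ≤ N τ)
    (hload : ∀ τ ∈ good, ∀ u ∈ U, ∑ y : {y // ty y = τ}, κ (px y) u ≤ (1 + η) * N τ / U.card)
    (hsum : (1 + 2 * η) * ∑ τ ∈ good, (N τ : ℝ) ≤ U.card)
    (hlog : Real.log ((Fintype.card J + 1) * (2 + 2 * Fintype.card V + Fintype.card W))
      ≤ δ ^ 2 * Fintype.card V / 4) :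
    ∃ B : J → Finset V, (∀ τ, B τ ⊆ U) ∧ (∀ τ τ', τ ≠ τ' → Disjoint (B τ) (B τ')) ∧
      ∀ τ ∈ good, (B τ).card ≤ (1 + 2 * η) * N τ + δ * Fintype.card V ∧
        (1 + 2 * η) * N τ - δ * Fintype.card V ≤ (B τ).card ∧
        (∀ s a, (1 + 2 * η) * N τ * (1 / 2 + α / 2) - δ * Fintype.card V
          ≤ (dirNbr D s a ∩ B τ).card) ∧
        ∃ g : {y // ty y = τ} → V, Function.Injective g ∧
          ∀ y, g y ∈ B τ ∧ κ (px y) (g y) ≠ 0 := by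
  set n : ℝ := (Fintype.card V : ℝ) with hn
  have hUpos : (0 : ℝ) < U.card := by exact_mod_cast hU.card_pos
  have hnpos : 0 < n := lt_of_lt_of_le hUpos (by rw [hn]; exact_mod_cast Finset.card_le_univ U)
  set q : J → ℝ := fun τ => if τ ∈ good then (1 + 2 * η) * N τ / U.card else 0 with hq
  have hq0 : ∀ τ, 0 ≤ q τ := fun τ => by
    simp only [hq]; split_ifs <;> positivity
  have hqs : ∑ τ, q τ ≤ 1 := by
    simp only [hq]
    rw [← Finset.sum_filter, Finset.filter_mem_eq_inter, Finset.univ_inter, ← Finset.sum_div,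
      div_le_one hUpos, ← Finset.mul_sum]
    exact hsum
  -- The colour `none` takes the unused part of `U`. Kernels are rescaled by `U.card / c` to become
  -- weightings bounded by one.
  obtain ⟨χ, hχ⟩ := exists_coloring_dirNbr (ι := Option J) (J := W) D U
    (fun o => o.elim (1 - ∑ τ, q τ) q)
    (by rintro (_ | τ); exacts [by simpa using hqs, hq0 τ])
    (by simp [Fintype.sum_option])
    (fun x u => κ x u * (U.card / c)) (fun x u => mul_nonneg (hκ0 x u) (by positivity))
    (fun x u => by
      have := hκ1 x u
      rw [le_div_iff₀ hUpos] at this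
      rw [← mul_div_assoc, div_le_one hc]
      exact this)
    hδ0 hδ1 (m := n) (by rw [hn]; exact_mod_cast Finset.card_le_univ U)
    (by simpa using hlog)
  refine ⟨fun τ => U.filter (χ · = some τ), fun τ => Finset.filter_subset _ _,
    fun τ τ' hne => ?_, fun τ hτ => ?_⟩
  · rw [Finset.disjoint_left]
    intro a ha hb
    exact hne (Option.some_injective _
      ((Finset.mem_filter.mp ha).2.symm.trans (Finset.mem_filter.mp hb).2))
  · obtain ⟨h1, h2, h3, h4⟩ := hχ (some τ)
    have hqτ : q τ = (1 + 2 * η) * N τ / U.card := by simp only [hq, if_pos hτ]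
    have hqU : q τ * U.card = (1 + 2 * η) * N τ := by rw [hqτ]; field_simp
    simp only [Option.elim_some] at h1 h2 h3 h4
    rw [hqU] at h1 h2
    refine ⟨h1, h2, fun s a => ?_, ?_⟩
    · have h5 := h3 s a
      have h6 := mul_le_mul_of_nonneg_left (hdU s a) (hq0 τ)
      have h7 : q τ * ((1 / 2 + α / 2) * U.card) = (1 + 2 * η) * N τ * (1 / 2 + α / 2) := by
        rw [← hqU]; ring
      linarith
    · have hNpos : (0 : ℝ) < N τ := lt_of_lt_of_le (by positivity) (hN τ hτ)
      refine exists_injective_of_weights (U.filter (χ · = some τ))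
        (fun (y : {y // ty y = τ}) u => κ (px y) u) (fun y u => hκ0 _ u)
        (κ := (1 + η) * N τ / U.card) (by positivity) (fun y => ?_)
        (fun u hu => hload τ hτ u (Finset.mem_filter.mp hu).1)
      have h5 := h4 (px y)
      rw [← Finset.sum_mul, ← Finset.sum_mul, hκs y (by rw [y.2]; exact hτ), one_mul] at h5
      have h6 : q τ * (U.card / c) = (1 + 2 * η) * N τ / c := by rw [← hqU]; ring
      rw [h6] at h5
      -- The splitting error is at most the difference between the share `1 + 2 * η` given to a type
      -- and the load bound `1 + η`, so rows still outweigh columns.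
      have h7 : δ * n * c ≤ η * N τ := by
        calc δ * n * c = (δ * c) * n := by ring
          _ ≤ η * γ * n := mul_le_mul_of_nonneg_right hδc hnpos.le
          _ = η * (γ * n) := by ring
          _ ≤ η * N τ := mul_le_mul_of_nonneg_left (hN τ hτ) hη
      rw [div_le_iff₀ hUpos]
      have h8 : ((1 + 2 * η) * N τ / c - δ * n) * c
          ≤ ((∑ u ∈ U with χ u = some τ, κ (px y) u) * (U.card / c)) * c :=
        mul_le_mul_of_nonneg_right h5 hc.le
      have h9 : ((1 + 2 * η) * N τ / c - δ * n) * c = (1 + 2 * η) * N τ - δ * n * c := by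
        field_simp
      have h10 : ((∑ u ∈ U with χ u = some τ, κ (px y) u) * (U.card / c)) * c
          = (∑ u ∈ U with χ u = some τ, κ (px y) u) * U.card := by field_simp
      rw [h9, h10] at h8
      linarith

end DigraphTrees

/-! ### Loads, sizes and proportions -/

namespace DigraphTrees

/-- Each term of a sum of exponentials is at most the whole sum; taking logarithms bounds every load
at once. -/
theorem load_le_of_sum_exp_le {V W J : Type*} [Fintype J] (U : Bool → Finset V) (sg : J → Bool)
    (C : Finset W) (wt : J → W → ℝ) (y : J → W → V → ℝ) {ξ b : ℝ} (hb : 0 < b)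
    (h : ∑ τ, ∑ u ∈ U (sg τ), Real.exp (∑ x ∈ C, (y τ x u - ξ * wt τ x)) ≤ Real.exp 1 * b)
    (τ : J) {u : V} (hu : u ∈ U (sg τ)) :
    ∑ x ∈ C, y τ x u ≤ 1 + Real.log b + ξ * ∑ x ∈ C, wt τ x := by
  have h1 : Real.exp (∑ x ∈ C, (y τ x u - ξ * wt τ x)) ≤ Real.exp 1 * b := by
    refine le_trans ?_ h
    refine le_trans ?_ (Finset.single_le_sum (f := fun τ => ∑ u ∈ U (sg τ),
      Real.exp (∑ x ∈ C, (y τ x u - ξ * wt τ x)))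
      (fun τ _ => Finset.sum_nonneg fun u _ => (Real.exp_pos _).le) (Finset.mem_univ τ))
    exact Finset.single_le_sum (f := fun u => Real.exp (∑ x ∈ C, (y τ x u - ξ * wt τ x)))
      (fun u _ => (Real.exp_pos _).le) hu
  have h2 := Real.log_le_log (Real.exp_pos _) h1
  rw [Real.log_exp, Real.log_mul (Real.exp_pos _).ne' hb.ne', Real.log_exp,
    Finset.sum_sub_distrib, ← Finset.mul_sum] at h2
  linarith

theorem sum_card_mul_size_le {W J : Type*} [Fintype W] [Fintype J] [DecidableEq J] {ℓ : ℕ}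
    (S : Fin ℓ → Set W) (hS : ∀ i j, i ≠ j → Disjoint (S i) (S j)) (size : J → ℕ)
    (ty : Fin ℓ → J) (hsize : ∀ i, size (ty i) = (S i).ncard) :
    ∑ τ, Fintype.card {y // ty y = τ} * size τ ≤ Fintype.card W := by
  classical
  have h1 : ∀ τ, Fintype.card {y // ty y = τ} * size τ
      = ∑ i ∈ Finset.univ.filter (ty · = τ), size (ty i) := by
    intro τ
    rw [Fintype.card_subtype, ← smul_eq_mul, ← Finset.sum_const]
    exact Finset.sum_congr rfl fun i hi => by rw [(Finset.mem_filter.mp hi).2]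
  simp_rw [h1]
  rw [Finset.sum_fiberwise]
  simp_rw [hsize, Set.ncard_eq_toFinset_card']
  rw [← Finset.card_biUnion]
  · exact Finset.card_le_univ _
  · intro i _ j _ hij
    exact Set.disjoint_toFinset.mpr (hS i j hij)

theorem dirNbr_proportion {α δ q n a b : ℝ} (hn : 0 < n) (hα : α ≤ 1) (hδ : 0 ≤ δ)
    (hq : 8 * δ ≤ α * q) (ha : a ≤ q * n + 2 * δ * n)
    (hb : q * ((1 / 2 + α) * n) - 2 * δ * n ≤ b) (hα0 : 0 ≤ α) : (1 / 2 + α / 2) * a ≤ b := by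
  have h1 : (1 / 2 + α / 2) * a ≤ (1 / 2 + α / 2) * (q * n + 2 * δ * n) :=
    mul_le_mul_of_nonneg_left ha (by linarith)
  have h2 : 8 * δ * n ≤ α * q * n := mul_le_mul_of_nonneg_right hq hn.le
  have h3 : α * (δ * n) ≤ δ * n := mul_le_of_le_one_left (by positivity) hα
  linarith

/-- The hypotheses of the matching lemma: a set of size about `(1 + 2 * η) * N` has room for `N`
vertices, and a vertex misses less than `N / 2` of it, since `α` outweighs `η` and the errors. -/
theorem copies_numerics {α δ η γ n N : ℝ} {b c X : ℕ} (hX : N = X) (hn : 0 < n)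
    (hα : α ≤ 1) (hη0 : 0 < η) (hη : 8 * η ≤ α) (hδη : δ ≤ η * γ) (hδα : 16 * δ ≤ α * γ)
    (hN : γ * n ≤ N) (hN0 : 0 ≤ N) (h1 : (b : ℝ) ≤ (1 + 2 * η) * N + 2 * δ * n)
    (h2 : (1 + 2 * η) * N - 2 * δ * n ≤ b)
    (h3 : (1 + 2 * η) * N * (1 / 2 + α / 2) - 2 * δ * n ≤ c) :
    X ≤ b ∧ 2 * b ≤ 2 * c + X := by
  have e1 : δ * n ≤ η * N := by
    calc δ * n ≤ η * γ * n := mul_le_mul_of_nonneg_right hδη hn.le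
      _ = η * (γ * n) := by ring
      _ ≤ η * N := mul_le_mul_of_nonneg_left hN hη0.le
  have e2 : 16 * (δ * n) ≤ α * N := by
    calc 16 * (δ * n) = 16 * δ * n := by ring
      _ ≤ α * γ * n := mul_le_mul_of_nonneg_right hδα hn.le
      _ = α * (γ * n) := by ring
      _ ≤ α * N := mul_le_mul_of_nonneg_left hN (by linarith)
  have e3 : 8 * (η * N) ≤ α * N := by nlinarith
  have e4 : 0 ≤ η * α * N := mul_nonneg (mul_nonneg hη0.le (by linarith)) hN0
  constructor
  · have : (X : ℝ) ≤ b := by rw [← hX]; linarith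
    exact_mod_cast this
  · have : 2 * (b : ℝ) ≤ 2 * c + X := by rw [← hX]; linarith
    exact_mod_cast this

/-- Different attached subtrees have different roots. This brings the degree bounds of `T` into the
load estimates. -/
theorem RootedAttaching.card_roots_le {W : Type*} [Fintype W] {T : Digraph W} {T' : Set W}
    {ℓ : ℕ} {S : Fin ℓ → Set W} {t : W} {par : W → W} {rk : W → ℕ} {e : Fin ℓ → ℕ → W}
    {p : Fin ℓ → ℕ → ℕ} {idx : Fin ℓ → W → ℕ}
    (hR : RootedAttaching T T' S t par rk e p idx) (h : IsFormedByAttaching T T' S) (ht : t ∈ T')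
    (s : Bool) (x : W) (F : Finset (Fin ℓ))
    (hF : ∀ i ∈ F, parDir T par (e i 0) = s ∧ par (e i 0) = x) :
    F.card ≤ (dirNbr T s x).card := by
  refine Finset.card_le_card_of_injOn (fun i => e i 0) (fun i hi => ?_) fun i _ j _ hij => ?_
  · obtain ⟨h1, h2⟩ := hF i hi
    have hne : e i 0 ≠ t := fun hh =>
      Set.disjoint_left.mp (h.disjoint_core i) (hh ▸ ht) (hR.enum_mem i 0 (hR.pos i)).1
    rw [Finset.mem_coe, mem_dirNbr, ← h2]
    cases s with
    | true =>
      simp only [parDir, decide_eq_true_eq] at h1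
      exact h1
    | false =>
      simp only [parDir, decide_eq_false_iff_not] at h1
      exact (hR.adj_par _ hne).resolve_left h1
  · by_contra hne
    have h1 := (hR.enum_mem i 0 (hR.pos i)).1
    have h2 := (hR.enum_mem j 0 (hR.pos j)).1
    have hij' : e i 0 = e j 0 := hij
    exact Set.disjoint_left.mp (h.disjoint_attached i j hne) h1 (hij' ▸ h2)

/-- The proportions of the host partition: `Sum.inl s` for the roots attached in direction `s`,
`(τ, j)` for the `j`-th vertices of the subtrees of type `τ`, and the rest for the core. -/
noncomputable def hostFraction {J : Type*} [Fintype J] [DecidableEq J] (K : ℕ) (good : Finset J)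
    (sg : J → Bool) (size N : J → ℕ) (η ε n : ℝ) : Bool ⊕ (J × Fin K) ⊕ Unit → ℝ
  | Sum.inl s => (∑ τ ∈ good with sg τ = s, (N τ : ℝ)) / n + ε / 8
  | Sum.inr (Sum.inl q) =>
    if q.1 ∈ good ∧ 0 < q.2.val ∧ q.2.val < size q.1 then (1 + 2 * η) * N q.1 / n else 0
  | Sum.inr (Sum.inr _) => 1 - (∑ s, ((∑ τ ∈ good with sg τ = s, (N τ : ℝ)) / n + ε / 8)
      + ∑ q : J × Fin K, if q.1 ∈ good ∧ 0 < q.2.val ∧ q.2.val < size q.1 then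
          (1 + 2 * η) * N q.1 / n else 0)

theorem sum_hostFraction {J : Type*} [Fintype J] [DecidableEq J] (K : ℕ) (good : Finset J)
    (sg : J → Bool) (size N : J → ℕ) (η ε n : ℝ) :
    ∑ i, hostFraction K good sg size N η ε n i = 1 := by
  rw [Fintype.sum_sum_type, Fintype.sum_sum_type]
  simp only [hostFraction, Finset.univ_unique, Finset.sum_const, Finset.card_singleton, one_smul]
  ring

/-- The good subtrees occupy at most `(1 + 2 * η) * (1 - ε)` and the two extra shares `ε / 4`, which
leaves `ε / 2` as `η` is small against `ε`. -/
theorem le_hostFraction_rest {J : Type*} [Fintype J] [DecidableEq J] (K : ℕ) (good : Finset J)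
    (sg : J → Bool) (size N : J → ℕ) {η ε n : ℝ} (hn : 0 < n) (hη0 : 0 < η) (hη : 40 * η ≤ ε)
    (hsize : ∀ τ ∈ good, 0 < size τ)
    (hN : ∑ τ ∈ good, (N τ : ℝ) * size τ ≤ (1 - ε) * n) :
    ε / 2 ≤ hostFraction K good sg size N η ε n (Sum.inr (Sum.inr ())) := by
  simp only [hostFraction]
  have h1 : ∑ s, ((∑ τ ∈ good with sg τ = s, (N τ : ℝ)) / n + ε / 8)
      = (∑ τ ∈ good, (N τ : ℝ)) / n + ε / 4 := by
    rw [Finset.sum_add_distrib, ← Finset.sum_div, Finset.sum_fiberwise]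
    simp
    ring
  have h2 : ∑ q : J × Fin K, (if q.1 ∈ good ∧ 0 < q.2.val ∧ q.2.val < size q.1 then
      (1 + 2 * η) * N q.1 / n else 0)
      ≤ ∑ τ ∈ good, (1 + 2 * η) * N τ / n * (size τ - 1) := by
    rw [Fintype.sum_prod_type, ← Finset.sum_filter_add_sum_filter_not Finset.univ (· ∈ good)]
    rw [Finset.sum_eq_zero (s := Finset.univ.filter (· ∉ good)), add_zero,
      Finset.filter_mem_eq_inter, Finset.univ_inter]
    · refine Finset.sum_le_sum fun τ hτ => ?_
      simp only [hτ, true_and]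
      rw [← Finset.sum_filter, Finset.sum_const, nsmul_eq_mul, mul_comm]
      refine mul_le_mul_of_nonneg_left ?_ (by positivity)
      have h3 : ((Finset.univ : Finset (Fin K)).filter
          fun j => 0 < j.val ∧ j.val < size τ).card ≤ (Finset.Ioo 0 (size τ)).card :=
        Finset.card_le_card_of_injOn (fun j => j.val) (fun j hj => by simpa using hj)
          fun i _ j _ hij => Fin.ext hij
      rw [Nat.card_Ioo] at h3
      have h4 := hsize τ hτ
      have h5 : ((Finset.univ : Finset (Fin K)).filter
          fun j => 0 < j.val ∧ j.val < size τ).card + 1 ≤ size τ := by omega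
      have h6 : (((Finset.univ : Finset (Fin K)).filter
          fun j => 0 < j.val ∧ j.val < size τ).card : ℝ) + 1 ≤ size τ := by exact_mod_cast h5
      linarith
    · intro τ hτ
      simp [(Finset.mem_filter.mp hτ).2]
  have h3 : ∑ τ ∈ good, (1 + 2 * η) * N τ / n * (size τ - 1)
      = (1 + 2 * η) / n * ∑ τ ∈ good, (N τ : ℝ) * size τ - (1 + 2 * η) / n * ∑ τ ∈ good, (N τ : ℝ) := by
    rw [← mul_sub, ← Finset.sum_sub_distrib, Finset.mul_sum]
    exact Finset.sum_congr rfl fun τ _ => by ring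
  have h4 : (1 + 2 * η) / n * ∑ τ ∈ good, (N τ : ℝ) * size τ ≤ (1 + 2 * η) * (1 - ε) := by
    rw [div_mul_eq_mul_div, div_le_iff₀ hn, mul_assoc]
    exact mul_le_mul_of_nonneg_left hN (by positivity)
  have h5 : (∑ τ ∈ good, (N τ : ℝ)) / n ≤ (1 + 2 * η) / n * ∑ τ ∈ good, (N τ : ℝ) := by
    rw [div_mul_eq_mul_div]
    refine div_le_div_of_nonneg_right ?_ hn.le
    have : 0 ≤ ∑ τ ∈ good, (N τ : ℝ) := Finset.sum_nonneg fun _ _ => Nat.cast_nonneg _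
    nlinarith
  rw [h1]
  nlinarith

end DigraphTrees

/-! ### Assembling the embedding -/

namespace DigraphTrees

theorem card_core_le {W J : Type*} [Fintype W] [DecidableEq W] [Fintype J] [DecidableEq J] {ℓ : ℕ}
    (T' : Set W) (S : Fin ℓ → Set W) (ty : Fin ℓ → J) (good : Finset J) (C : Finset W)
    (hC : ∀ x ∈ C, x ∈ T' ∨ ∃ i, ty i ∉ good ∧ x ∈ S i) {K : ℕ} (hK : ∀ i, (S i).ncard ≤ K)
    {b : ℝ} (hb0 : 0 ≤ b) (hb : ∀ τ ∉ good, (Fintype.card {y // ty y = τ} : ℝ) ≤ b) :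
    (C.card : ℝ) ≤ T'.ncard + Fintype.card J * b * K := by
  classical
  set bad : Finset (Fin ℓ) := Finset.univ.filter fun i => ty i ∉ good with hbad
  have hsub : C ⊆ T'.toFinset ∪ bad.biUnion fun i => (S i).toFinset := by
    intro x hx
    rcases hC x hx with h | ⟨i, hi, h⟩
    · exact Finset.mem_union_left _ (by simpa using h)
    · exact Finset.mem_union_right _ (Finset.mem_biUnion.mpr
        ⟨i, by simpa [hbad] using hi, by simpa using h⟩)
  have h1 : C.card ≤ T'.ncard + bad.card * K := by
    refine (Finset.card_le_card hsub).trans ((Finset.card_union_le _ _).trans ?_)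
    rw [Set.ncard_eq_toFinset_card' T']
    refine Nat.add_le_add_left ?_ _
    refine Finset.card_biUnion_le_card_mul _ _ _ fun i _ => ?_
    rw [← Set.ncard_eq_toFinset_card']
    exact hK i
  have h2 : (bad.card : ℝ) ≤ Fintype.card J * b := by
    have e : bad.card = ∑ τ ∈ goodᶜ, Fintype.card {y // ty y = τ} := by
      rw [Finset.card_eq_sum_card_fiberwise (f := ty) (t := goodᶜ)
        (fun i hi => by simpa [hbad] using hi)]
      refine Finset.sum_congr rfl fun τ hτ => ?_
      rw [Fintype.card_subtype]
      congr 1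
      ext i
      simp only [hbad, Finset.mem_filter, Finset.mem_univ, true_and, and_iff_right_iff_imp]
      rintro rfl
      simpa using hτ
    rw [e]
    push_cast
    calc _ ≤ ∑ _τ ∈ goodᶜ, b := Finset.sum_le_sum fun τ hτ => hb τ (by simpa using hτ)
      _ = (goodᶜ.card : ℝ) * b := by rw [Finset.sum_const, nsmul_eq_mul]
      _ ≤ _ := mul_le_mul_of_nonneg_right (by exact_mod_cast Finset.card_le_univ _) hb0
  have h3 : (C.card : ℝ) ≤ T'.ncard + bad.card * K := by exact_mod_cast h1
  have h4 : (bad.card : ℝ) * K ≤ Fintype.card J * b * K :=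
    mul_le_mul_of_nonneg_right h2 (Nat.cast_nonneg _)
  linarith

set_option maxHeartbeats 1000000 in
-- The whole embedding argument, with the hierarchy of constants replaced by the explicit
-- inequalities that it uses.
theorem RootedAttaching.containsCopyAt_of_numerics {V W J : Type*} [Fintype V] [Fintype W]
    [Fintype J] {D : Digraph V} {T : Digraph W} {T' : Set W}
    {ℓ : ℕ} {S : Fin ℓ → Set W} {t : W} {par : W → W} {rk : W → ℕ} {e : Fin ℓ → ℕ → W}
    {p : Fin ℓ → ℕ → ℕ} {idx : Fin ℓ → W → ℕ}
    (hR : RootedAttaching T T' S t par rk e p idx) (hT : IsOrientedTree T)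
    (h : IsFormedByAttaching T T' S) (ht : t ∈ T') (v : V)
    (size : J → ℕ) (pJ : J → ℕ → ℕ) (dJ : J → ℕ → Bool) (ty : Fin ℓ → J)
    (hsize : ∀ i, size (ty i) = (S i).ncard)
    (hdJ : ∀ i, ∀ j < (S i).ncard, dJ (ty i) j = parDir T par (e i j))
    (hpJ : ∀ i j, 0 < j → j < (S i).ncard → pJ (ty i) j = p i j)
    {K : ℕ} (hK1 : 1 ≤ K) (hK : ∀ i, (S i).ncard ≤ K) {α ε μ η γ δ l Δ n : ℝ} (hn : n = Fintype.card V)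
    (hdeg : ∀ s a, (1 / 2 + α) * n ≤ (dirNbr D s a).card)
    (hW : (Fintype.card W : ℝ) ≤ (1 - ε) * n)
    (hΔ : ∀ s x, ((dirNbr T s x).card : ℝ) ≤ Δ) (hT' : (T'.ncard : ℝ) ≤ μ * n)
    (hα0 : 0 < α) (hα1 : α ≤ 1) (hε0 : 0 < ε) (hε1 : ε ≤ 1) (hη0 : 0 < η) (hηα : 8 * η ≤ α)
    (hηε : 40 * η ≤ ε) (hγ0 : 0 < γ) (hγμ : Fintype.card J * γ * K ≤ μ) (hμ : 16 * μ ≤ α * ε)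
    (hδ0 : 0 < δ) (hδη : δ * (1 / (α / 2 * (η / 16))) ≤ η * γ) (hδε : 64 * δ ≤ α * ε)
    (hδγ : 16 * δ ≤ α * γ) (hδn : 1 ≤ δ * n) (hηn : 256 ≤ η * ε * n)
    (hl0 : 0 < l) (hl : 1 + Real.log (Fintype.card J * n) ≤ η / 2 * l)
    (hlΔ : l * Δ / (γ * n) * (1 / (α / 2 * (η / 16))) ≤ η / 16)
    (hlog : Real.log ((Fintype.card J * K + 3) * (2 + 3 * n)) ≤ δ ^ 2 * n / 4) :
    ContainsCopyAt D T t v := by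
  classical
  have hnpos : 0 < n := by
    rw [hn]; exact_mod_cast Fintype.card_pos_iff.mpr ⟨v⟩
  have hWn : (Fintype.card W : ℝ) ≤ n := hW.trans (mul_le_of_le_one_left hnpos.le (by linarith))
  set N : J → ℕ := fun τ => Fintype.card {y // ty y = τ} with hN
  set sg : J → Bool := fun τ => dJ τ 0 with hsg
  set good : Finset J := Finset.univ.filter fun τ => γ * n ≤ N τ with hgood
  have hgoodN : ∀ τ ∈ good, γ * n ≤ N τ := fun τ hτ => (Finset.mem_filter.mp hτ).2
  have hNpos : ∀ τ ∈ good, (0 : ℝ) < N τ := fun τ hτ =>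
    lt_of_lt_of_le (by positivity) (hgoodN τ hτ)
  have hmember : ∀ τ ∈ good, ∃ i, ty i = τ := fun τ hτ => by
    have h1 : 0 < N τ := by exact_mod_cast hNpos τ hτ
    obtain ⟨y⟩ := Fintype.card_pos_iff.mp h1
    exact ⟨y.1, y.2⟩
  have hsizepos : ∀ τ ∈ good, 0 < size τ := fun τ hτ => by
    obtain ⟨i, rfl⟩ := hmember τ hτ
    rw [hsize]; exact hR.pos i
  have hNsize : ∑ τ ∈ good, (N τ : ℝ) * size τ ≤ (1 - ε) * n := by
    refine le_trans ?_ hW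
    refine le_trans (Finset.sum_le_univ_sum_of_nonneg fun τ => by positivity) ?_
    exact_mod_cast sum_card_mul_size_le S h.disjoint_attached size ty hsize
  have hNsum : ∑ τ ∈ good, (N τ : ℝ) ≤ n := by
    refine le_trans (Finset.sum_le_sum fun τ hτ => ?_) (hNsize.trans
      (mul_le_of_le_one_left hnpos.le (by linarith)))
    have : (1 : ℝ) ≤ size τ := by exact_mod_cast hsizepos τ hτ
    exact le_mul_of_one_le_right (hNpos τ hτ).le this
  -- the host partition
  set q := hostFraction K good sg size N η ε n with hq
  have hq_inl : ∀ s, q (Sum.inl s) = (∑ τ ∈ good with sg τ = s, (N τ : ℝ)) / n + ε / 8 :=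
    fun s => rfl
  have hq_mid : ∀ (τ : J) (j : Fin K), q (Sum.inr (Sum.inl (τ, j))) =
      if τ ∈ good ∧ 0 < j.val ∧ j.val < size τ then (1 + 2 * η) * N τ / n else 0 :=
    fun τ j => rfl
  have hq_rest : ε / 2 ≤ q (Sum.inr (Sum.inr ())) :=
    le_hostFraction_rest K good sg size N hnpos hη0 hηε hsizepos hNsize
  have hq0 : ∀ i, 0 ≤ q i := by
    rintro (s | ⟨τ, j⟩ | u)
    · rw [hq_inl]
      have : 0 ≤ ∑ τ ∈ good with sg τ = s, (N τ : ℝ) :=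
        Finset.sum_nonneg fun _ _ => Nat.cast_nonneg _
      positivity
    · rw [hq_mid]; split_ifs <;> positivity
    · exact le_trans (by positivity) hq_rest
  have hδ1 : δ ≤ 1 := by
    have := mul_le_one₀ hα1 hε0.le hε1
    linarith
  have hlogs : ∀ x : ℝ, 0 < x → x ≤ (Fintype.card J * K + 3) * (2 + 3 * n) →
      Real.log x ≤ δ ^ 2 * n / 4 := fun x hx hx' => (Real.log_le_log hx hx').trans hlog
  obtain ⟨P, hPv, hPd, hP⟩ := exists_host_partition D v (α := α) (δ := δ)
    (by rw [← hn]; exact hdeg) q hq0 (sum_hostFraction K good sg size N η ε n) hδ0 hδ1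
    (by rw [← hn]; exact hδn) (by
      rw [← hn]
      refine hlogs _ ?_ ?_
      · simp only [Fintype.card_sum, Fintype.card_prod, Fintype.card_bool, Fintype.card_fin,
          Fintype.card_unit]
        positivity
      · simp only [Fintype.card_sum, Fintype.card_prod, Fintype.card_bool, Fintype.card_fin,
          Fintype.card_unit]
        push_cast
        exact mul_le_mul (by linarith) (by linarith) (by positivity) (by positivity))
  rw [← hn] at hP
  set R := P (Sum.inr (Sum.inr ())) with hRdef
  set U : Bool → Finset V := fun s => P (Sum.inl s) with hU
  have hqU : ∀ s, ε / 8 ≤ q (Sum.inl s) := fun s => by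
    rw [hq_inl]
    have : 0 ≤ (∑ τ ∈ good with sg τ = s, (N τ : ℝ)) / n :=
      div_nonneg (Finset.sum_nonneg fun _ _ => Nat.cast_nonneg _) hnpos.le
    linarith
  have hαε : α * ε ≤ ε := mul_le_of_le_one_left hε0.le hα1
  have hδεn : 64 * (δ * n) ≤ ε * n := by
    have := mul_le_mul_of_nonneg_right (hδε.trans hαε) hnpos.le
    linarith
  have hUlow : ∀ s, ε * n / 16 ≤ (U s).card := fun s => by
    have h1 := (hP (Sum.inl s)).2.1
    have h2 := mul_le_mul_of_nonneg_right (hqU s) hnpos.le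
    linarith
  have hRlow : ε * n / 4 ≤ R.card := by
    have h1 := (hP (Sum.inr (Sum.inr ()))).2.1
    have h2 := mul_le_mul_of_nonneg_right hq_rest hnpos.le
    linarith
  have hεn : 0 < ε * n := by positivity
  have hUpos : ∀ s, (0 : ℝ) < (U s).card := fun s => lt_of_lt_of_le (by positivity) (hUlow s)
  have hUne : ∀ s, (U s).Nonempty := fun s => by
    rw [← Finset.card_pos]; exact_mod_cast hUpos s
  have hRpos : (0 : ℝ) < R.card := lt_of_lt_of_le (by positivity) hRlow
  have hdU : ∀ s' s a, (1 / 2 + α / 2) * ((U s').card : ℝ) ≤ (dirNbr D s a ∩ U s').card :=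
    fun s' s a => dirNbr_proportion hnpos hα1 hδ0.le
      (by have := mul_le_mul_of_nonneg_left (hqU s') hα0.le; linarith) (hP (Sum.inl s')).1
      ((hP (Sum.inl s')).2.2 s a) hα0.le
  have hdR : ∀ s a, (1 / 2 + α / 2) * (R.card : ℝ) ≤ (dirNbr D s a ∩ R).card := fun s a =>
    dirNbr_proportion hnpos hα1 hδ0.le
      (by have := mul_le_mul_of_nonneg_left hq_rest hα0.le; linarith)
      (hP _).1 ((hP _).2.2 s a) hα0.le
  -- embedding the core
  set C : Finset W := Finset.univ.filter fun x => x ∈ T' ∨ ∃ i, ty i ∉ good ∧ x ∈ S i with hC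
  have hCmem : ∀ x, x ∈ C ↔ x ∈ T' ∨ ∃ i, ty i ∉ good ∧ x ∈ S i := fun x => by simp [hC]
  have hCcard : (C.card : ℝ) ≤ α / 2 * R.card := by
    have h1 := card_core_le T' S ty good C (fun x hx => (hCmem x).mp hx) hK
      (b := γ * n) (by positivity) (fun τ hτ => by
        simp only [hgood, Finset.mem_filter, Finset.mem_univ, true_and, not_le] at hτ
        exact hτ.le)
    have h2 : (Fintype.card J : ℝ) * (γ * n) * K ≤ μ * n := by
      have := mul_le_mul_of_nonneg_right hγμ hnpos.le
      linarith
    have h3 := mul_le_mul_of_nonneg_right hμ hnpos.le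
    have h4 := mul_le_mul_of_nonneg_left hRlow hα0.le
    linarith
  have hroot : ∀ i, par (e i 0) ∈ C := fun i => (hCmem _).mpr (Or.inl (hR.par_root i))
  set k : J → W → ℕ := fun τ x =>
    (Finset.univ.filter fun y : {y // ty y = τ} => par (e y 0) = x).card with hk
  have hkΔ : ∀ τ x, (k τ x : ℝ) ≤ Δ := fun τ x => by
    refine le_trans ?_ (hΔ (sg τ) x)
    have := hR.card_roots_le h ht (sg τ) x
      ((Finset.univ.filter fun y : {y // ty y = τ} => par (e y 0) = x).map
        (Function.Embedding.subtype _)) (by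
        intro i hi
        obtain ⟨y, hy, rfl⟩ := Finset.mem_map.mp hi
        refine ⟨?_, (Finset.mem_filter.mp hy).2⟩
        have h1 := hdJ y.1 0 (hR.pos y.1)
        rw [y.2] at h1
        exact h1.symm)
    rw [Finset.card_map] at this
    exact_mod_cast this
  have hfib : ∀ τ (g : W → ℝ), ∑ y : {y // ty y = τ}, g (par (e y 0))
      = ∑ x ∈ C, k τ x * g x := by
    intro τ g
    rw [← Finset.sum_fiberwise_of_maps_to (t := C) (g := fun y : {y // ty y = τ} => par (e y 0))
      (fun y _ => hroot y)]
    refine Finset.sum_congr rfl fun x _ => ?_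
    rw [hk, ← nsmul_eq_mul, ← Finset.sum_const]
    exact Finset.sum_congr rfl fun y hy => by rw [(Finset.mem_filter.mp hy).2]
  have hksum : ∀ τ, ∑ x ∈ C, (k τ x : ℝ) = N τ := fun τ => by
    have := hfib τ fun _ => 1
    simp only [mul_one] at this
    rw [← this, Finset.sum_const, nsmul_eq_mul, mul_one, Finset.card_univ]
  -- Normalised so that each good type has total weight `l` over the core. The potential then bounds
  -- a load relative to `l`, and `l` must be at least of order `log n / η`.
  set wt : J → W → ℝ := fun τ x => if τ ∈ good then l * k τ x / N τ else 0 with hwt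
  have hwt0 : ∀ τ x, 0 ≤ wt τ x := fun τ x => by
    simp only [hwt]; split_ifs <;> positivity
  -- This constant bounds the density of the kernels relative to the uniform distributions; the
  -- potential argument runs with `β = η / 16`.
  have hCc : 0 < 1 / (α / 2 * (η / 16)) := by positivity
  have hwts : ∀ τ x, wt τ x * (1 / (α / 2 * (η / 16))) ≤ η / 16 := fun τ x => by
    simp only [hwt]
    split_ifs with hτ
    · refine le_trans (mul_le_mul_of_nonneg_right ?_ hCc.le) hlΔ
      have h1 := hNpos τ hτ
      have h2 := hgoodN τ hτ
      have h3 := hkΔ τ x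
      have h4 : 0 ≤ Δ := le_trans (Nat.cast_nonneg _) h3
      gcongr
    · rw [zero_mul]; positivity
  have hη1 : η ≤ 1 / 8 := by linarith
  have hsize16 : ∀ s, 1 ≤ η / 16 * ((U s).card : ℝ) := fun s => by
    have := mul_le_mul_of_nonneg_left (hUlow s) hη0.le
    linarith
  obtain ⟨φ, κ, hφt, hφinj, hφR, hφe, hκ, hpot⟩ := exists_balanced_embedding D par rk
    (parDir T par) t v R U sg wt hwt0 hα0 (β := η / 16) (by positivity) (by linarith)
    hsize16 (fun s => by
      have := hsize16 s
      have := mul_le_mul_of_nonneg_right (show η / 16 ≤ α / 2 by linarith) (hUpos s).le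
      linarith)
    (by rw [← Finset.card_pos]; exact_mod_cast hRpos) hdR (fun s a => hdU s s a) hwts C
    ((hCmem t).mpr (Or.inl ht)) (fun x hx hxt => by
      refine ⟨?_, hR.rk_lt x hxt⟩
      rcases (hCmem x).mp hx with hx' | ⟨i, hi, hx'⟩
      · exact (hCmem _).mpr (Or.inl (hR.par_core x hx' hxt))
      · have a1 := hR.idx_lt i x hx'
        rcases Nat.eq_zero_or_pos (idx i x) with h0 | h0
        · have a2 := hR.par_root i
          rw [← h0, a1.2] at a2
          exact (hCmem _).mpr (Or.inl a2)
        · have a2 := hR.par_enum i _ h0 a1.1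
          rw [a1.2] at a2
          rw [a2.2]
          exact (hCmem _).mpr (Or.inr ⟨i, hi, (hR.enum_mem i _ (by omega)).1⟩))
    hCcard
  have hUsum : ∀ τ : J, (0 : ℝ) < ∑ τ, ((U (sg τ)).card : ℝ) := fun τ =>
    Finset.sum_pos (fun τ _ => hUpos _) ⟨τ, Finset.mem_univ _⟩
  have hUsum_le : ∑ τ, ((U (sg τ)).card : ℝ) ≤ Fintype.card J * n := by
    rw [← nsmul_eq_mul, ← Finset.card_univ]
    refine Finset.sum_le_card_nsmul _ _ _ fun τ _ => ?_
    rw [hn]; exact_mod_cast Finset.card_le_univ _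
  have hload : ∀ τ ∈ good, ∀ u ∈ U (sg τ), ∑ x ∈ C, (k τ x : ℝ) * κ x (sg τ) u
      ≤ (1 + η) * N τ / (U (sg τ)).card := by
    intro τ hτ u hu
    have h1 := load_le_of_sum_exp_le U sg C wt (fun τ x u => wt τ x * (U (sg τ)).card * κ x (sg τ) u)
      (hUsum τ) hpot τ hu
    have hNτ := hNpos τ hτ
    have hUτ := hUpos (sg τ)
    have e1 : ∑ x ∈ C, wt τ x = l := by
      simp only [hwt, if_pos hτ]
      rw [← Finset.sum_div, ← Finset.mul_sum, hksum]
      field_simp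
    have e2 : ∑ x ∈ C, wt τ x * (U (sg τ)).card * κ x (sg τ) u
        = l * (U (sg τ)).card / N τ * ∑ x ∈ C, (k τ x : ℝ) * κ x (sg τ) u := by
      simp only [hwt, if_pos hτ]
      rw [Finset.mul_sum]
      exact Finset.sum_congr rfl fun x _ => by ring
    rw [e1, e2] at h1
    have h2 : Real.log (∑ τ, ((U (sg τ)).card : ℝ)) ≤ Real.log (Fintype.card J * n) :=
      Real.log_le_log (hUsum τ) hUsum_le
    have h3 : (1 + 4 * (η / 16)) * (1 + η / 16) * l ≤ (1 + 3 / 8 * η) * l := by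
      refine mul_le_mul_of_nonneg_right ?_ hl0.le
      have := mul_le_mul_of_nonneg_left hη1 hη0.le
      linarith
    -- The discount rate accounts for `1 + 3 / 8 * η`, and the logarithm of the initial potential
    -- for another `η / 2`.
    have h4 : l * (U (sg τ)).card / N τ * ∑ x ∈ C, (k τ x : ℝ) * κ x (sg τ) u ≤ (1 + η) * l := by
      have := mul_pos hη0 hl0
      linarith
    rw [le_div_iff₀ hUτ]
    rw [div_mul_eq_mul_div, div_le_iff₀ hNτ] at h4
    refine le_of_mul_le_mul_left ?_ hl0
    calc l * ((∑ x ∈ C, (k τ x : ℝ) * κ x (sg τ) u) * (U (sg τ)).card)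
        = l * (U (sg τ)).card * ∑ x ∈ C, (k τ x : ℝ) * κ x (sg τ) u := by ring
      _ ≤ (1 + η) * l * N τ := h4
      _ = l * ((1 + η) * N τ) := by ring
  -- the roots of the attached subtrees
  have hmatch := fun s => exists_root_matching D (U s) (hUne s) ty (fun y => par (e y 0))
    (fun x => if x ∈ C then κ x s else 0) (good.filter (sg · = s)) (α := α) (δ := δ)
    (η := η) (γ := γ) hCc
    (fun x u => by
      split_ifs with hx
      · exact (hκ x hx).nonneg s u
      · exact le_rfl)
    (fun x u => by
      split_ifs with hx
      · exact (hκ x hx).le s u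
      · exact div_nonneg hCc.le (hUpos s).le)
    (fun y _ => by
      simp only [if_pos (hroot y)]
      exact (hκ _ (hroot y)).sum_eq_one s)
    (hdU s) hδ0 hδ1 hη0.le hγ0 hδη N
    (fun τ hτ => by rw [← hn]; exact hgoodN τ (Finset.mem_filter.mp hτ).1)
    (fun τ hτ u hu => by
      obtain ⟨hτ1, rfl⟩ := Finset.mem_filter.mp hτ
      simp only [hroot, if_true]
      rw [hfib τ fun x => κ x (sg τ) u]
      exact hload τ hτ1 u hu)
    -- Capacity of `U s`: its extra share `ε / 8` pays for the factor `1 + 2 * η` and for the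
    -- splitting error.
    (by
      have h1 := (hP (Sum.inl s)).2.1
      rw [hq_inl] at h1
      have h2 : ((∑ τ ∈ good with sg τ = s, (N τ : ℝ)) / n + ε / 8) * n
          = (∑ τ ∈ good with sg τ = s, (N τ : ℝ)) + ε * n / 8 := by field_simp
      rw [h2] at h1
      have h3 : ∑ τ ∈ good with sg τ = s, (N τ : ℝ) ≤ n :=
        (Finset.sum_le_sum_of_subset_of_nonneg (Finset.filter_subset _ _)
          fun _ _ _ => Nat.cast_nonneg _).trans hNsum
      have h4 := mul_le_mul_of_nonneg_left h3 hη0.le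
      have h5 := mul_le_mul_of_nonneg_right hηε hnpos.le
      have h6 : ((U s).card : ℝ) = (P (Sum.inl s)).card := rfl
      linarith)
    (by
      rw [← hn]
      refine hlogs _ (by positivity) ?_
      have hK1' : (1 : ℝ) ≤ K := by exact_mod_cast hK1
      have h1 : (Fintype.card J : ℝ) ≤ Fintype.card J * K :=
        le_mul_of_one_le_right (Nat.cast_nonneg _) hK1'
      refine mul_le_mul (by linarith) (by linarith) (by positivity) (by positivity))
  choose B₀ hB₀U hB₀d hB₀ using hmatch
  -- the remaining vertices of the attached subtrees
  set B : J → ℕ → Finset V := fun τ j => if j = 0 then B₀ (sg τ) τ else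
    if hj : j < K then P (Sum.inr (Sum.inl (τ, ⟨j, hj⟩))) else ∅ with hB
  have hB_zero : ∀ τ, B τ 0 = B₀ (sg τ) τ := fun τ => by simp [hB]
  have hB_pos : ∀ τ j (hj : j < K), 0 < j → B τ j = P (Sum.inr (Sum.inl (τ, ⟨j, hj⟩))) :=
    fun τ j hj h0 => by simp only [hB, if_neg h0.ne', dif_pos hj]
  have hsizeK : ∀ τ ∈ good, size τ ≤ K := fun τ hτ => by
    obtain ⟨i, rfl⟩ := hmember τ hτ
    rw [hsize]; exact hK i
  have hδη' : δ ≤ η * γ := by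
    refine le_trans (le_mul_of_one_le_right hδ0.le ?_) hδη
    rw [le_div_iff₀ (by positivity), one_mul]
    exact mul_le_one₀ (by linarith) (by positivity) (by linarith)
  have hBnum : ∀ τ ∈ good, ∀ j < size τ, N τ ≤ (B τ j).card ∧
      ∀ s a, 2 * (B τ j).card ≤ 2 * (dirNbr D s a ∩ B τ j).card + N τ := by
    intro τ hτ j hj
    have key : (B τ j).card ≤ (1 + 2 * η) * N τ + 2 * δ * n ∧
        (1 + 2 * η) * N τ - 2 * δ * n ≤ (B τ j).card ∧
        ∀ s a, (1 + 2 * η) * N τ * (1 / 2 + α / 2) - 2 * δ * n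
          ≤ (dirNbr D s a ∩ B τ j).card := by
      rcases Nat.eq_zero_or_pos j with rfl | h0
      · obtain ⟨b1, b2, b3, -⟩ := hB₀ (sg τ) τ (Finset.mem_filter.mpr ⟨hτ, rfl⟩)
        rw [← hn] at b1 b2 b3
        rw [hB_zero]
        have : 0 < δ * n := by positivity
        exact ⟨by linarith, by linarith, fun s a => by have := b3 s a; linarith⟩
      · have hjK : j < K := hj.trans_le (hsizeK τ hτ)
        rw [hB_pos τ j hjK h0]
        obtain ⟨b1, b2, b3⟩ := hP (Sum.inr (Sum.inl (τ, ⟨j, hjK⟩)))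
        rw [hq_mid, if_pos ⟨hτ, h0, hj⟩] at b1 b2 b3
        have e1 : (1 + 2 * η) * N τ / n * n = (1 + 2 * η) * N τ := by field_simp
        have e2 : (1 + 2 * η) * N τ / n * ((1 / 2 + α) * n)
            = (1 + 2 * η) * N τ * (1 / 2 + α) := by field_simp
        rw [e1] at b1 b2
        rw [e2] at b3
        refine ⟨b1, b2, fun s a => le_trans ?_ (b3 s a)⟩
        have : 0 ≤ (1 + 2 * η) * N τ * α := by positivity
        linarith
    have hnum := fun s a => copies_numerics (X := N τ) rfl hnpos hα1 hη0 hηα hδη' hδγ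
      (hgoodN τ hτ) (Nat.cast_nonneg _) key.1 key.2.1 (key.2.2 s a)
    exact ⟨(hnum true v).1, fun s a => (hnum s a).2⟩
  have hcopies : ∀ τ, ∃ ψ : ℕ → {y // ty y = τ} → V, τ ∈ good →
      (∀ y : {y // ty y = τ}, κ (par (e y 0)) (sg τ) (ψ 0 y) ≠ 0) ∧
      ∀ j < size τ, Function.Injective (ψ j) ∧ (∀ y, ψ j y ∈ B τ j) ∧
        (0 < j → ∀ y, DirAdj D (dJ τ j) (ψ (pJ τ j) y) (ψ j y)) := by
    intro τ
    by_cases hτ : τ ∈ good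
    · obtain ⟨-, -, -, g, hg, hg'⟩ := hB₀ (sg τ) τ (Finset.mem_filter.mpr ⟨hτ, rfl⟩)
      obtain ⟨ψ, hψ0, hψ⟩ := exists_copies_of_dirNbr D (size τ) (pJ τ) (dJ τ)
        (fun j h0 hj => by
          obtain ⟨i, rfl⟩ := hmember τ hτ
          rw [hsize] at hj
          rw [hpJ i j h0 hj]
          exact (hR.par_enum i j h0 hj).1) (B τ) g hg
        (fun y => by rw [hB_zero]; exact (hg' y).1)
        (fun j hj => (hBnum τ hτ j hj).1) (fun j hj => (hBnum τ hτ j hj).2)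
      refine ⟨ψ, fun _ => ⟨fun y => ?_, hψ⟩⟩
      have := (hg' y).2
      rw [if_pos (hroot y)] at this
      rw [hψ0]; exact this
    · exact ⟨fun _ _ => v, fun h => absurd h hτ⟩
  choose ψ hψ using hcopies
  -- disjointness
  have hBP : ∀ τ ∈ good, ∀ j < size τ, ∃ i : Bool ⊕ (J × Fin K) ⊕ Unit,
      i ≠ Sum.inr (Sum.inr ()) ∧ B τ j ⊆ P i := by
    intro τ hτ j hj
    rcases Nat.eq_zero_or_pos j with rfl | h0
    · exact ⟨Sum.inl (sg τ), by simp, by rw [hB_zero]; exact hB₀U _ _⟩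
    · exact ⟨_, by simp, (hB_pos τ j (hj.trans_le (hsizeK τ hτ)) h0).le⟩
  have hBd : ∀ τ ∈ good, ∀ j < size τ, ∀ τ' ∈ good, ∀ j' < size τ', ∀ u, u ∈ B τ j →
      u ∈ B τ' j' → τ = τ' ∧ j = j' := by
    intro τ hτ j hj τ' hτ' j' hj' u hu hu'
    have hPu : ∀ i i', u ∈ P i → u ∈ P i' → i = i' := fun i i' h1 h2 => by
      by_contra hne
      exact Finset.disjoint_left.mp (hPd i i' hne) h1 h2
    rcases Nat.eq_zero_or_pos j with rfl | h0 <;> rcases Nat.eq_zero_or_pos j' with rfl | h0'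
    · rw [hB_zero] at hu hu'
      have h1 := hPu _ _ (hB₀U _ _ hu) (hB₀U _ _ hu')
      rw [Sum.inl.injEq] at h1
      rw [h1] at hu
      refine ⟨?_, rfl⟩
      by_contra hne
      exact Finset.disjoint_left.mp (hB₀d (sg τ') τ τ' hne) hu hu'
    · rw [hB_zero] at hu
      rw [hB_pos τ' j' (hj'.trans_le (hsizeK τ' hτ')) h0'] at hu'
      have h1 := hPu _ _ (hB₀U _ _ hu) hu'
      simp at h1
    · rw [hB_zero] at hu'
      rw [hB_pos τ j (hj.trans_le (hsizeK τ hτ)) h0] at hu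
      have h1 := hPu _ _ hu (hB₀U _ _ hu')
      simp at h1
    · rw [hB_pos τ j (hj.trans_le (hsizeK τ hτ)) h0] at hu
      rw [hB_pos τ' j' (hj'.trans_le (hsizeK τ' hτ')) h0'] at hu'
      have h1 := hPu _ _ hu hu'
      simpa using h1
  have hψmem : ∀ i, ty i ∈ good → ∀ j < (S i).ncard, ψ (ty i) j ⟨i, rfl⟩ ∈ B (ty i) j :=
    fun i hi j hj => ((hψ (ty i) hi).2 j (by rw [hsize]; exact hj)).2.1 _
  refine hR.containsCopyAt hT h ht (fun i => ty i ∈ good) (C : Set W)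
    (fun x => by rw [Finset.mem_coe]; exact hCmem x) v φ hφt hφinj
    (fun x hx => hφe x (Finset.mem_coe.mp hx)) (fun i j => ψ (ty i) j ⟨i, rfl⟩) ?_ ?_ ?_ ?_
  · intro i hi j hj i' hi' j' hj' heq
    have h1 := hψmem i hi j hj
    have h2 := hψmem i' hi' j' hj'
    have heq' : ψ (ty i) j ⟨i, rfl⟩ = ψ (ty i') j' ⟨i', rfl⟩ := heq
    rw [← heq'] at h2
    obtain ⟨hty, rfl⟩ := hBd _ hi j (by rw [hsize]; exact hj) _ hi' j'
      (by rw [hsize]; exact hj') _ h1 h2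
    -- The two copies have equal types only propositionally; the family is transported along this
    -- equality before injectivity of `ψ τ j` applies.
    have h3 : ∀ τ (hτ : ty i' = τ), ψ (ty i') j ⟨i', rfl⟩ = ψ τ j ⟨i', hτ⟩ := by
      rintro _ rfl; rfl
    rw [h3 _ hty.symm] at heq'
    have h4 := ((hψ (ty i) hi).2 j (by rw [hsize]; exact hj)).1 heq'
    exact ⟨congrArg Subtype.val h4, rfl⟩
  · intro i hi j hj x hx heq
    have h1 := hψmem i hi j hj
    obtain ⟨k, hk1, hk2⟩ := hBP _ hi j (by rw [hsize]; exact hj)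
    have h2 := hk2 h1
    have heq' : ψ (ty i) j ⟨i, rfl⟩ = φ x := heq
    rw [heq'] at h2
    by_cases hxt : x = t
    · rw [hxt, hφt] at h2
      exact hPv k h2
    · exact Finset.disjoint_left.mp (hPd k _ hk1) h2 (hφR x hx hxt)
  · intro i hi
    have h1 := (hψ (ty i) hi).1 ⟨i, rfl⟩
    have h2 := ((hκ _ (hroot i)).support _ _ h1).2
    rw [← hdJ i 0 (hR.pos i)]
    exact h2
  · intro i hi j h0 hj
    have h1 := ((hψ (ty i) hi).2 j (by rw [hsize]; exact hj)).2.2 h0 ⟨i, rfl⟩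
    rw [← hdJ i j hj, ← hpJ i j h0 hj]
    exact h1

end DigraphTrees

/-! ### The hierarchy of constants -/

namespace DigraphTrees

/-- An upper bound for the number of types of attached subtrees on at most `K` vertices,
times `K`. -/
def typeBound (K : ℕ) : ℕ := (K + 1) * K ^ K * 2 ^ K * K

theorem typeBound_mono : Monotone typeBound := by
  intro a b hab
  rcases Nat.eq_zero_or_pos a with rfl | ha
  · simp [typeBound]
  · have h1 : a ^ a ≤ b ^ b := (Nat.pow_le_pow_left hab a).trans
      (Nat.pow_le_pow_right (by omega) hab)
    have h2 : 2 ^ a ≤ 2 ^ b := Nat.pow_le_pow_right (by norm_num) hab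
    unfold typeBound
    gcongr

theorem typeBound_pos {K : ℕ} (hK : 1 ≤ K) : 1 ≤ typeBound K := by
  unfold typeBound
  exact Nat.one_le_iff_ne_zero.mpr (by positivity)

/-- The function expressing the hierarchy of constants. -/
noncomputable def hierarchyBound (x : ℝ) : ℝ :=
  x ^ 10 / (10 ^ 10 * (typeBound ⌈1 / x⌉₊ : ℝ) ^ 2)

theorem one_le_typeBound_ceil {x : ℝ} (hx : 0 < x) : (1 : ℝ) ≤ typeBound ⌈1 / x⌉₊ := by
  exact_mod_cast typeBound_pos (Nat.ceil_pos.mpr (by positivity))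

theorem hierarchyBound_pos {x : ℝ} (hx : 0 < x) : 0 < hierarchyBound x := by
  have := one_le_typeBound_ceil hx
  unfold hierarchyBound
  positivity

theorem hierarchyBound_le {x : ℝ} (hx : 0 < x) : hierarchyBound x ≤ x ^ 10 / 10 ^ 10 := by
  have h := one_le_typeBound_ceil hx
  unfold hierarchyBound
  refine div_le_div_of_nonneg_left (by positivity) (by positivity) ?_
  nlinarith

theorem hierarchyBound_one_div (K : ℕ) :
    hierarchyBound (1 / K) = (1 / K : ℝ) ^ 10 / (10 ^ 10 * (typeBound K : ℝ) ^ 2) := by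
  unfold hierarchyBound
  rw [one_div_one_div, Nat.ceil_natCast]

theorem hierarchyBound_monotoneOn : MonotoneOn hierarchyBound (Set.Ioc 0 1) := by
  intro x hx y hy hxy
  have hx0 : 0 < x := hx.1
  have h1 := one_le_typeBound_ceil hy.1
  have h2 : (typeBound ⌈1 / y⌉₊ : ℝ) ≤ typeBound ⌈1 / x⌉₊ := by
    exact_mod_cast typeBound_mono (Nat.ceil_mono (one_div_le_one_div_of_le hx0 hxy))
  unfold hierarchyBound
  gcongr

theorem hierarchyBound_mapsTo :
    Set.MapsTo hierarchyBound (Set.Ioc 0 1) (Set.Ioc 0 1) := by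
  intro x hx
  refine ⟨hierarchyBound_pos hx.1, (hierarchyBound_le hx.1).trans ?_⟩
  have : x ^ 10 ≤ 1 := pow_le_one₀ hx.1.le hx.2
  linarith

/-- `16 * μ` is at most both `α ^ 2` and `ε ^ 2`, hence at most their geometric mean. -/
theorem mul_le_of_hierarchy {α ε μ : ℝ} (hα : α ∈ Set.Ioc (0 : ℝ) 1) (hε : ε ∈ Set.Ioc (0 : ℝ) 1)
    (hμ : μ ∈ Set.Ioc (0 : ℝ) 1) (hμα : μ ≤ hierarchyBound α) (hμε : μ ≤ hierarchyBound ε) :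
    16 * μ ≤ α * ε := by
  have key : ∀ x : ℝ, x ∈ Set.Ioc (0 : ℝ) 1 → μ ≤ hierarchyBound x → 16 * μ ≤ x ^ 2 :=
    fun x hx h => by
      have h1 := h.trans (hierarchyBound_le hx.1)
      have h2 : x ^ 10 ≤ x ^ 2 := pow_le_pow_of_le_one hx.1.le hx.2 (by norm_num)
      have h3 : 0 ≤ x ^ 2 := sq_nonneg x
      linarith
  have h1 := key α hα hμα
  have h2 := key ε hε hμε
  have h3 : (16 * μ) * (16 * μ) ≤ α ^ 2 * ε ^ 2 :=
    mul_le_mul h1 h2 (by linarith [hμ.1]) (sq_nonneg _)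
  refine le_of_sq_le_sq ?_ (mul_nonneg hα.1.le hε.1.le)
  nlinarith

/-- The geometric mean of the bounds for `c` in terms of `μ` and of `K` is `μ ^ 5 / (10 ^ 10 *
typeBound K)`, and `α`, `α * ε` are bounded below through `μ`. With `η = α * ε / 100` and `γ = μ /
typeBound K` the conclusion reads `3072 * c ≤ α * η ^ 3 * γ`, from which the later inequalities
follow. -/
theorem le_of_hierarchy {α ε μ c : ℝ} {K : ℕ} (hα : α ∈ Set.Ioc (0 : ℝ) 1)
    (hε : ε ∈ Set.Ioc (0 : ℝ) 1) (hμ : μ ∈ Set.Ioc (0 : ℝ) 1) (hc : c ∈ Set.Ioc (0 : ℝ) 1)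
    (hK : 1 ≤ K) (hμα : 16 * μ ≤ α * ε) (hcμ : c ≤ hierarchyBound μ)
    (hcK : c ≤ hierarchyBound (1 / K)) :
    3072 * c ≤ α * (α * ε / 100) ^ 3 * (μ / typeBound K) := by
  have hL : (1 : ℝ) ≤ typeBound K := by exact_mod_cast typeBound_pos hK
  have h1 : c ≤ μ ^ 10 / 10 ^ 10 := hcμ.trans (hierarchyBound_le hμ.1)
  have h2 : c ≤ 1 / (10 ^ 10 * (typeBound K : ℝ) ^ 2) := by
    refine hcK.trans ?_
    rw [hierarchyBound_one_div]
    refine div_le_div_of_nonneg_right ?_ (by positivity)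
    refine pow_le_one₀ (by positivity) ?_
    rw [div_le_one (by positivity)]
    exact_mod_cast hK
  have h3 : c ^ 2 ≤ (μ ^ 5 / (10 ^ 10 * typeBound K)) ^ 2 := by
    calc c ^ 2 = c * c := sq c
      _ ≤ μ ^ 10 / 10 ^ 10 * (1 / (10 ^ 10 * (typeBound K : ℝ) ^ 2)) :=
        mul_le_mul h1 h2 hc.1.le (by have := hμ.1; positivity)
      _ = _ := by field_simp
  have hμ0 := hμ.1
  have h4 : c ≤ μ ^ 5 / (10 ^ 10 * typeBound K) :=
    le_of_sq_le_sq h3 (by positivity)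
  have h5 : μ ≤ α := by
    have : α * ε ≤ α := mul_le_of_le_one_right hα.1.le hε.2
    linarith
  have h6 : μ * (16 * μ / 100) ^ 3 ≤ α * (α * ε / 100) ^ 3 := by
    gcongr
    exact hα.1.le
  calc 3072 * c ≤ 3072 * (μ ^ 5 / (10 ^ 10 * typeBound K)) := by linarith
    _ = 3072 / 10 ^ 10 * (μ ^ 4 * (μ / typeBound K)) := by field_simp
    _ ≤ (16 / 100) ^ 3 * (μ ^ 4 * (μ / typeBound K)) := by gcongr; norm_num
    _ = μ * (16 * μ / 100) ^ 3 * (μ / typeBound K) := by ring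
    _ ≤ _ := by gcongr

/-- The logarithm is at most of order `√n`, by `log r ≤ r - 1` at `r = √n`, whereas `c ^ 2 * n ≥ 100
* √n`. -/
theorem log_le_of_hierarchy {c n b : ℝ} (hc0 : 0 < c) (hc1 : c ≤ 1) (hn : 10 ^ 4 ≤ c ^ 4 * n)
    (hb0 : 0 ≤ b) (hb : b * c ≤ 1) : Real.log ((b + 3) * (2 + 3 * n)) ≤ c ^ 2 * n / 4 := by
  have hn0 : 0 < n := by
    by_contra h
    have : c ^ 4 * n ≤ 0 := mul_nonpos_of_nonneg_of_nonpos (by positivity) (by linarith)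
    linarith
  have hcn : 10 ^ 4 ≤ c * n := by
    have : c ^ 4 ≤ c := by simpa using pow_le_pow_of_le_one hc0.le hc1 (show 1 ≤ 4 by norm_num)
    nlinarith
  have hn1 : 10 ^ 4 ≤ n := by nlinarith
  set r := Real.sqrt n with hr
  have hr2 : r ^ 2 = n := Real.sq_sqrt hn0.le
  have hr1 : 1 ≤ r := Real.one_le_sqrt.mpr (by linarith)
  have hbn : b ≤ n := by
    refine le_of_mul_le_mul_right ?_ hc0
    linarith
  have h1 : (b + 3) * (2 + 3 * n) ≤ 20 * n ^ 2 := by nlinarith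
  have h2 : Real.log (20 * n ^ 2) ≤ 19 + 4 * r := by
    have e : (20 : ℝ) * n ^ 2 = 20 * r ^ 4 := by rw [← hr2]; ring
    rw [e, Real.log_mul (by norm_num) (by positivity), Real.log_pow]
    have a1 := Real.log_le_sub_one_of_pos (show (0 : ℝ) < 20 by norm_num)
    have a2 := Real.log_le_sub_one_of_pos (show 0 < r by linarith)
    push_cast
    linarith
  have h3 : 100 ≤ c ^ 2 * r := by
    refine le_of_sq_le_sq ?_ (by positivity)
    calc (100 : ℝ) ^ 2 = 10 ^ 4 := by norm_num
      _ ≤ c ^ 4 * n := hn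
      _ = (c ^ 2 * r) ^ 2 := by rw [← hr2]; ring
  have h4 : 100 * r ≤ c ^ 2 * n := by
    calc 100 * r ≤ c ^ 2 * r * r := mul_le_mul_of_nonneg_right h3 (by linarith)
      _ = c ^ 2 * n := by rw [← hr2]; ring
  have h5 := Real.log_le_log (by positivity) h1
  linarith

theorem card_dirNbr_true {V : Type*} [Fintype V] (D : Digraph V) (a : V) :
    (dirNbr D true a).card = outDegree D a := by
  unfold outDegree
  rw [← Set.ncard_coe_finset]
  congr 1
  ext w
  rw [Finset.mem_coe, mem_dirNbr]
  rfl

theorem card_dirNbr_false {V : Type*} [Fintype V] (D : Digraph V) (a : V) :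
    (dirNbr D false a).card = inDegree D a := by
  unfold inDegree
  rw [← Set.ncard_coe_finset]
  congr 1
  ext w
  rw [Finset.mem_coe, mem_dirNbr]
  rfl

theorem minSemidegree_le_card_dirNbr {V : Type*} [Fintype V] (D : Digraph V) (s : Bool) (a : V) :
    minSemidegree D ≤ (dirNbr D s a).card := by
  have h : minSemidegree D ≤ min (outDegree D a) (inDegree D a) :=
    ciInf_le (OrderBot.bddBelow _) a
  cases s
  · rw [card_dirNbr_false]; exact h.trans (min_le_right _ _)
  · rw [card_dirNbr_true]; exact h.trans (min_le_left _ _)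

theorem card_dirNbr_le_max {V : Type*} [Fintype V] (D : Digraph V) (s : Bool) (a : V) :
    (dirNbr D s a).card ≤ if s then maxOutDegree D else maxInDegree D := by
  cases s
  · rw [card_dirNbr_false]
    exact le_ciSup (f := inDegree D) (Set.finite_range _).bddAbove a
  · rw [card_dirNbr_true]
    exact le_ciSup (f := outDegree D) (Set.finite_range _).bddAbove a

/-- Codes for the attached subtrees: number of vertices, parents, and directions of edges. -/
abbrev SubtreeCode (K : ℕ) := Fin (K + 1) × (Fin K → Fin K) × (Fin K → Bool)

theorem card_subtreeCode_mul (K : ℕ) : Fintype.card (SubtreeCode K) * K = typeBound K := by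
  simp [SubtreeCode, typeBound, mul_assoc]

end DigraphTrees

set_option maxHeartbeats 1000000 in
/-- The hierarchy `1/n ≪ c ≪ μ ≪ α, ε` and `c ≪ 1/K` is expressed by one non-decreasing function
`f : (0,1] → (0,1]`, a relation `a ≪ b` standing for `a ≤ f b`. -/
theorem mainTheorem4 :
    ∃ f : ℝ → ℝ, MonotoneOn f (Set.Ioc 0 1) ∧ Set.MapsTo f (Set.Ioc 0 1) (Set.Ioc 0 1) ∧
      ∀ (α ε μ c : ℝ) (K n : ℕ),
        α ∈ Set.Ioc (0 : ℝ) 1 → ε ∈ Set.Ioc (0 : ℝ) 1 → μ ∈ Set.Ioc (0 : ℝ) 1 →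
        c ∈ Set.Ioc (0 : ℝ) 1 → 1 ≤ K → 1 ≤ n →
        (1 : ℝ) / n ≤ f c → c ≤ f μ → μ ≤ f α → μ ≤ f ε → c ≤ f (1 / (K : ℝ)) →
        ∀ (V : Type*) [Fintype V] (D : Digraph V) (v : V),
          Fintype.card V = n →
          (1 / 2 + α) * n ≤ (DigraphTrees.minSemidegree D : ℝ) →
          ∀ (W : Type*) [Fintype W] (T : Digraph W) (ℓ : ℕ) (T' : Set W) (S : Fin ℓ → Set W)
            (t : W),
            DigraphTrees.IsOrientedTree T →
            (Fintype.card W : ℝ) ≤ (1 - ε) * n →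
            (DigraphTrees.maxOutDegree T : ℝ) ≤ c * n / Real.log n →
            (DigraphTrees.maxInDegree T : ℝ) ≤ c * n / Real.log n →
            DigraphTrees.IsFormedByAttaching T T' S →
            (T'.ncard : ℝ) ≤ μ * n →
            (∀ i, (S i).ncard ≤ K) →
            t ∈ T' →
            DigraphTrees.ContainsCopyAt D T t v := by
  open DigraphTrees in
  refine ⟨hierarchyBound, hierarchyBound_monotoneOn, hierarchyBound_mapsTo, ?_⟩
  intro α ε μ c K n hα hε hμ hc hK hn hnc hcμ hμα hμε hcK V _ D v hV hD W _ T ℓ T' S t hT hW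
    hout hin hatt hT' hS ht
  have h16 := mul_le_of_hierarchy hα hε hμ hμα hμε
  have hc3072 := le_of_hierarchy hα hε hμ hc hK h16 hcμ hcK
  obtain ⟨hα0, hα1⟩ := hα
  obtain ⟨hε0, hε1⟩ := hε
  obtain ⟨hμ0, hμ1⟩ := hμ
  obtain ⟨hc0, hc1⟩ := hc
  have hn0 : (0 : ℝ) < n := by exact_mod_cast hn
  have hK1 : (1 : ℝ) ≤ K := by exact_mod_cast hK
  have hL : (1 : ℝ) ≤ typeBound K := by exact_mod_cast typeBound_pos hK
  have hLJ : (Fintype.card (SubtreeCode K) : ℝ) * K = typeBound K := by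
    exact_mod_cast card_subtreeCode_mul K
  have hJL : (Fintype.card (SubtreeCode K) : ℝ) ≤ typeBound K := by
    rw [← hLJ]; exact le_mul_of_one_le_right (Nat.cast_nonneg _) hK1
  set η : ℝ := α * ε / 100 with hη
  -- Chosen so that number of types times `γ` times `K` is exactly `μ`: the rare subtrees then have
  -- at most `μ * n` vertices in total.
  set γ : ℝ := μ / typeBound K with hγ
  have hη0 : 0 < η := by positivity
  have hαε : α * ε ≤ α := mul_le_of_le_one_right hα0.le hε1
  have hαε' : α * ε ≤ ε := mul_le_of_le_one_left hε0.le hα1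
  have hη1 : η ≤ 1 := by rw [hη]; linarith
  have hγ0 : 0 < γ := by positivity
  have hγL : γ * typeBound K ≤ 1 := by rw [hγ]; field_simp; exact hμ1
  have hγ1 : γ ≤ 1 := (le_mul_of_one_le_right hγ0.le hL).trans hγL
  have hη2 : η ^ 2 ≤ η := pow_le_of_le_one hη0.le hη1 (by norm_num)
  have hη3 : η ^ 3 ≤ η ^ 2 := pow_le_pow_of_le_one hη0.le hη1 (by norm_num)
  have hcγ : 3072 * c ≤ γ := by
    refine hc3072.trans (mul_le_of_le_one_left hγ0.le ?_)
    exact mul_le_one₀ hα1 (by positivity) (by linarith)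
  have hn4 : 10 ^ 4 ≤ c ^ 4 * n := by
    have h1 := hnc.trans (hierarchyBound_le hc0)
    rw [div_le_iff₀ hn0] at h1
    have h2 : c ^ 10 ≤ c ^ 4 := pow_le_pow_of_le_one hc0.le hc1 (by norm_num)
    have h3 := mul_le_mul_of_nonneg_right h2 hn0.le
    linarith
  have hcn : 10 ^ 4 ≤ c * n := by
    have : c ^ 4 ≤ c := by simpa using pow_le_pow_of_le_one hc0.le hc1 (show 1 ≤ 4 by norm_num)
    exact hn4.trans (mul_le_mul_of_nonneg_right this hn0.le)
  have hn1 : (10 : ℝ) ^ 4 ≤ n := hcn.trans (mul_le_of_le_one_left hn0.le hc1)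
  have hlogn : 0 < Real.log n := Real.log_pos (by linarith)
  have hLc : (typeBound K : ℝ) * c ≤ 1 := by
    rw [mul_comm]
    exact (mul_le_mul_of_nonneg_right (by linarith) (by linarith)).trans hγL
  obtain ⟨par, rk, e, p, idx, hR⟩ := hatt.exists_rootedAttaching hT ht
  -- Code entries at positions beyond the size of a subtree are arbitrary. They may split a type
  -- into several, which is harmless since only the number of codes matters. The splitting error `δ`
  -- is `c` itself.
  refine hR.containsCopyAt_of_numerics (J := SubtreeCode K) hT hatt ht v (fun τ => τ.1.val)
    (fun τ j => if hj : j < K then (τ.2.1 ⟨j, hj⟩).val else 0)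
    (fun τ j => if hj : j < K then τ.2.2 ⟨j, hj⟩ else true)
    (fun i => (⟨(S i).ncard, Nat.lt_succ_of_le (hS i)⟩,
      fun j => if h : p i j < K then ⟨p i j, h⟩ else j, fun j => parDir T par (e i j)))
    (fun i => rfl) (fun i j hj => by simp only [dif_pos (hj.trans_le (hS i))])
    (fun i j h0 hj => by
      have h1 := (hR.par_enum i j h0 hj).1
      have h2 := hj.trans_le (hS i)
      simp only [dif_pos h2, dif_pos (h1.trans h2)])
    (K := K) hK hS (α := α) (ε := ε) (μ := μ) (η := η) (γ := γ) (δ := c)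
    (l := 6 / η * Real.log n) (Δ := c * n / Real.log n) (n := n) (by rw [hV])
    (fun s a => hD.trans (by exact_mod_cast minSemidegree_le_card_dirNbr D s a)) hW
    (fun s x => by
      have h1 : ((dirNbr T s x).card : ℝ) ≤ (if s then maxOutDegree T else maxInDegree T : ℕ) := by
        exact_mod_cast card_dirNbr_le_max T s x
      refine h1.trans ?_
      cases s
      · exact hin
      · exact hout)
    hT' hα0 hα1 hε0 hε1 hη0 (by rw [hη]; linarith) (by rw [hη]; linarith) hγ0 ?_ h16 hc0
    ?_ ?_ ?_ (by linarith) ?_ (by positivity) ?_ ?_ ?_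
  · rw [mul_right_comm, hLJ, hγ]
    exact le_of_eq (by field_simp)
  · rw [mul_one_div, div_le_iff₀ (by positivity)]
    have h1 : α * η ^ 3 * γ ≤ α * η ^ 2 * γ := by gcongr
    have h2 : η * γ * (α / 2 * (η / 16)) = α * η ^ 2 * γ / 32 := by ring
    linarith
  · have h1 : η * γ ≤ η := mul_le_of_le_one_right hη0.le hγ1
    have h2 : α * η ^ 3 * γ ≤ η := by
      calc α * η ^ 3 * γ ≤ 1 * η * 1 := by gcongr; linarith
        _ = η := by ring
    have h3 : η ≤ α * ε := by rw [hη]; linarith [mul_pos hα0 hε0]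
    linarith
  · have h2 : α * η ^ 3 * γ ≤ α * 1 * γ := by gcongr; linarith
    linarith
  · have h1 : α * η ^ 3 * γ ≤ 1 * η ^ 2 * 1 := by gcongr
    have h2 : η ≤ ε := by rw [hη]; linarith
    have h3 : η ^ 2 ≤ η * ε := by rw [sq]; gcongr
    have h4 : 3072 * c * n ≤ η * ε * n := mul_le_mul_of_nonneg_right (by linarith) hn0.le
    linarith
  · have hJpos : 0 < Fintype.card (SubtreeCode K) := by
      have : 0 < Fintype.card (SubtreeCode K) * K := by
        rw [card_subtreeCode_mul]; exact typeBound_pos hK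
      exact Nat.pos_of_mul_pos_right this
    have hJpos' : (0 : ℝ) < Fintype.card (SubtreeCode K) := by exact_mod_cast hJpos
    -- The factor `6 / η` in `l` leaves `3 * log n`, enough for `1 + log (J * n)` because `e * J ≤
    -- n` for the number `J` of codes.
    have e1 : η / 2 * (6 / η * Real.log n) = 3 * Real.log n := by field_simp; norm_num
    rw [e1, Real.log_mul hJpos'.ne' hn0.ne']
    have h1 : Real.exp 1 * Fintype.card (SubtreeCode K) ≤ n := by
      have h2 := Real.exp_one_lt_d9
      have h3 : Real.exp 1 ≤ 3 := by linarith
      have h4 : Real.exp 1 * Fintype.card (SubtreeCode K) ≤ 3 * typeBound K :=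
        mul_le_mul h3 hJL (Nat.cast_nonneg _) (by norm_num)
      refine h4.trans (le_of_mul_le_mul_right ?_ hc0)
      linarith
    have h2 := Real.log_le_log (by positivity) h1
    rw [Real.log_mul (Real.exp_pos _).ne' hJpos'.ne', Real.log_exp] at h2
    linarith
  -- The factor `log n` in `l` cancels against the one in the degree bound; this is where maximum
  -- degree `c * n / log n` is needed.
  · have e1 : 6 / η * Real.log n * (c * n / Real.log n) / (γ * n) * (1 / (α / 2 * (η / 16)))
        = 192 * c / (α * η ^ 2 * γ) := by
      field_simp
      norm_num
    rw [e1, div_le_iff₀ (by positivity)]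
    have : η / 16 * (α * η ^ 2 * γ) = α * η ^ 3 * γ / 16 := by ring
    linarith
  · rw [hLJ]
    exact log_le_of_hierarchy hc0 hc1 hn4 (by linarith) hLc
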